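/- Let $V\in L^1(\mathbb{R})$ be a complex-valued function. Let $H:=-\frac{d^2}{dx^2}+i\,\mathrm{sgn}(x)$ be the closed operator in $L^2(\mathbb{R})$ with domain $W^{2,2}(\mathbb{R})$, and let $$h(\psi,\phi):=\int_{\mathbb{R}}\psi'\,\overline{\phi'}\,dx+i\int_0^{\infty}\psi\,\overline{\phi}\,dx-i\int_{-\infty}^0\psi\,\overline{\phi}\,dx,\qquad v(\psi,\phi):=\int_{\mathbb{R}}V\,\psi\,\overline{\phi}\,dx,\qquad \psi,\phi\in W^{1,2}(\mathbb{R}).$$ For $\varepsilon\in\mathbb{R}$ let $H_\varepsilon=H\,\dot{+}\,\varepsilon V$ be the operator associated with the form $h+\varepsilon v$ on $W^{1,2}(\mathbb{R})$: its domain is the set of $\psi\in W^{1,2}(\mathbb{R})$ for which there is $\eta\in L^2(\mathbb{R})$ with $h(\psi,\phi)+\varepsilon v(\psi,\phi)=(\eta,\phi)=\int_{\mathbb{R}}\eta\,\overline{\phi}\,dx$ for all $\phi\in W^{1,2}(\mathbb{R})$, and $H_\varepsilon\psi:=\eta$. Put $V_{1/2}:=|V|^{1/2}e^{i\arg V}$.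 Let $z\in\mathbb{C}\setminus\sigma(H)$. Then for every $g\in L^2(\mathbb{R})$ there is a unique $\psi=:(H-z)^{-1}V_{1/2}\,g\in W^{1,2}(\mathbb{R})$ such that $$\int_{\mathbb{R}}V_{1/2}\,g\,\overline{\phi}\,dx=h(\psi,\phi)-z\,(\psi,\phi)\qquad\text{for all }\phi\in W^{1,2}(\mathbb{R}),$$ and $K_z g:=|V|^{1/2}(H-z)^{-1}V_{1/2}\,g$ defines a bounded operator $K_z$ on $L^2(\mathbb{R})$. The operator $K_z$ is Hilbert–Schmidt, and for every $\varepsilon\in\mathbb{R}$ $$z\in\sigma_{\mathrm{p}}(H_\varepsilon)\quad\Longleftrightarrow\quad -1\in\sigma(\varepsilon K_z),$$ where $\sigma_{\mathrm{p}}$ denotes the set of eigenvalues. -/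

import Mathlib

open MeasureTheory Set Filter Topology
open scoped ComplexConjugate ContDiff

noncomputable section

namespace BirmanSchwinger

/-! ### Unbounded operators, spectra, Hilbert-Schmidt operators -/

section Abstract

variable {E : Type*} [NormedAddCommGroup E] [InnerProductSpace ℂ E]

/-- The resolvent set of an unbounded operator `T`: the points `z` for which `T - z` is a bijection
from the domain of `T` onto the whole space with bounded inverse. -/
def resolventSet (T : E →ₗ.[ℂ] E) : Set ℂ :=
  {z | ∃ R : E →L[ℂ] E,
    (∀ f : E, ∃ h : R f ∈ T.domain, T ⟨R f, h⟩ - z • R f = f) ∧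
    (∀ u : T.domain, R (T u - z • (u : E)) = u)}

/-- The spectrum of an unbounded operator. -/
def spec (T : E →ₗ.[ℂ] E) : Set ℂ := (resolventSet T)ᶜ

/-- The point spectrum (the set of eigenvalues) of an unbounded operator. -/
def pointSpectrum (T : E →ₗ.[ℂ] E) : Set ℂ :=
  {z | ∃ u : T.domain, (u : E) ≠ 0 ∧ T u = z • (u : E)}

end Abstract

/-- Hilbert-Schmidt operators: the squares of the norms of the images of the vectors of an
orthonormal basis are summable, for every orthonormal basis. -/
def IsHilbertSchmidt {E : Type} [NormedAddCommGroup E] [InnerProductSpace ℂ E]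
    (K : E →L[ℂ] E) : Prop :=
  ∀ (ι : Type) (b : HilbertBasis ι ℂ E), Summable fun i => ‖K (b i)‖ ^ 2

/-! ### Sobolev spaces on the real line -/

/-- The Hilbert space `L²(ℝ)` of complex-valued functions. -/
abbrev L2R : Type := Lp ℂ 2 (volume : Measure ℝ)

/-- `w` is the weak derivative of `u`. -/
def HasWeakDeriv (u w : L2R) : Prop :=
  ∀ φ : ℝ → ℝ, ContDiff ℝ ∞ φ → HasCompactSupport φ →
    ∫ x, deriv φ x • u x = -∫ x, φ x • w x

lemma locInt (u : L2R) : LocallyIntegrable (u : ℝ → ℂ) volume :=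
  (Lp.memLp u).locallyIntegrable (by norm_num)

lemma integrable_test_smul {φ : ℝ → ℝ} (h1 : Continuous φ) (h2 : HasCompactSupport φ) (u : L2R) :
    Integrable (fun x => φ x • u x) volume :=
  (locInt u).integrable_smul_left_of_hasCompactSupport h1 h2

lemma continuous_deriv_test {φ : ℝ → ℝ} (h1 : ContDiff ℝ ∞ φ) : Continuous (deriv φ) :=
  h1.continuous_deriv (by simp)

lemma integral_test_add (φ : ℝ → ℝ) (h1 : Continuous φ) (h2 : HasCompactSupport φ) (u v : L2R) :
    ∫ x, φ x • (u + v : L2R) x = (∫ x, φ x • u x) + ∫ x, φ x • v x := by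
  rw [← integral_add (integrable_test_smul h1 h2 u) (integrable_test_smul h1 h2 v)]
  refine integral_congr_ae ?_
  filter_upwards [Lp.coeFn_add u v] with x hx
  rw [hx, Pi.add_apply, smul_add]

lemma integral_test_smul (φ : ℝ → ℝ) (c : ℂ) (u : L2R) :
    ∫ x, φ x • (c • u : L2R) x = c * ∫ x, φ x • u x := by
  rw [← integral_const_mul]
  refine integral_congr_ae ?_
  filter_upwards [Lp.coeFn_smul c u] with x hx
  rw [hx, Pi.smul_apply]
  simp only [smul_eq_mul, Complex.real_smul]
  ring

lemma HasWeakDeriv.add {u u' w w' : L2R} (h : HasWeakDeriv u w) (h' : HasWeakDeriv u' w') :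
    HasWeakDeriv (u + u') (w + w') := by
  intro φ h1 h2
  rw [integral_test_add _ (continuous_deriv_test h1) h2.deriv,
    integral_test_add _ h1.continuous h2, h φ h1 h2, h' φ h1 h2]
  ring

lemma HasWeakDeriv.smul (c : ℂ) {u w : L2R} (h : HasWeakDeriv u w) :
    HasWeakDeriv (c • u) (c • w) := by
  intro φ h1 h2
  rw [integral_test_smul, integral_test_smul, h φ h1 h2]
  ring

lemma eq_of_integral_test {u v : L2R}
    (h : ∀ φ : ℝ → ℝ, ContDiff ℝ ∞ φ → HasCompactSupport φ →
      ∫ x, φ x • u x = ∫ x, φ x • v x) : u = v :=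
  Lp.ext (ae_eq_of_integral_contDiff_smul_eq (locInt u) (locInt v) h)

lemma HasWeakDeriv.unique {u w w' : L2R} (h : HasWeakDeriv u w) (h' : HasWeakDeriv u w') :
    w = w' :=
  eq_of_integral_test fun φ h1 h2 => neg_injective ((h φ h1 h2).symm.trans (h' φ h1 h2))

/-- The Sobolev space `W^{1,2}(ℝ)`. -/
def W12 : Submodule ℂ L2R where
  carrier := {u | ∃ w, HasWeakDeriv u w}
  add_mem' := fun ⟨w, h⟩ ⟨w', h'⟩ => ⟨w + w', h.add h'⟩
  zero_mem' := ⟨0, by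
    have h0 : ∀ φ : ℝ → ℝ, ∫ x, φ x • (0 : L2R) x = 0 := fun φ => by
      have := integral_test_smul φ 0 0
      rwa [zero_smul, zero_mul] at this
    intro φ _ _
    rw [h0, h0, neg_zero]⟩
  smul_mem' := fun c _ ⟨w, h⟩ => ⟨c • w, h.smul c⟩

lemma hasWeakDeriv_choose (u : W12) : HasWeakDeriv u u.2.choose := u.2.choose_spec

/-- The weak derivative `u ↦ u'`, from `W^{1,2}(ℝ)` to `L²(ℝ)`. -/
def weakDeriv : W12 →ₗ[ℂ] L2R where
  toFun u := u.2.choose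
  map_add' u v := (hasWeakDeriv_choose (u + v)).unique
    ((hasWeakDeriv_choose u).add (hasWeakDeriv_choose v))
  map_smul' c u := (hasWeakDeriv_choose (c • u)).unique ((hasWeakDeriv_choose u).smul c)

lemma hasWeakDeriv_weakDeriv (u : W12) : HasWeakDeriv u (weakDeriv u) := u.2.choose_spec

/-- The Sobolev space `W^{2,2}(ℝ)`, as a subspace of `W^{1,2}(ℝ)`. -/
def W22' : Submodule ℂ W12 := W12.comap weakDeriv

/-- The Sobolev space `W^{2,2}(ℝ)`, as a subspace of `L²(ℝ)`. -/
def W22 : Submodule ℂ L2R := W22'.map W12.subtype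

lemma W22_le_W12 : W22 ≤ W12 := by
  rintro _ ⟨u, _, rfl⟩
  exact u.2

lemma weakDeriv_mem_of_W22 (u : W22) :
    weakDeriv (Submodule.inclusion W22_le_W12 u) ∈ W12 := by
  obtain ⟨_, u, hu, rfl⟩ := u
  exact hu

/-- The second weak derivative `u ↦ u''`, from `W^{2,2}(ℝ)` to `L²(ℝ)`. -/
def weakDeriv2 : W22 →ₗ[ℂ] L2R :=
  weakDeriv ∘ₗ
    ((weakDeriv ∘ₗ Submodule.inclusion W22_le_W12).codRestrict W12 weakDeriv_mem_of_W22)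

/-! ### The unperturbed operator -/

lemma memLp_sign_mul (u : L2R) :
    MemLp (fun x => ((Real.sign x : ℝ) : ℂ) * u x) 2 (volume : Measure ℝ) := by
  have hm : Measurable Real.sign := by
    unfold Real.sign
    exact Measurable.ite measurableSet_Iio measurable_const
      (Measurable.ite measurableSet_Ioi measurable_const measurable_const)
  refine (Lp.memLp u).of_le ?_ (ae_of_all _ fun x => ?_)
  · exact ((Complex.measurable_ofReal.comp hm).aestronglyMeasurable).mul (Lp.aestronglyMeasurable u)
  · rw [norm_mul, Complex.norm_real]
    refine mul_le_of_le_one_left (norm_nonneg _) ?_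
    rcases Real.sign_apply_eq x with h | h | h <;> rw [h] <;> norm_num

/-- Multiplication by the sign function in `L²(ℝ)`. -/
def sgnMul : L2R →ₗ[ℂ] L2R where
  toFun u := (memLp_sign_mul u).toLp _
  map_add' u v := by
    rw [← MemLp.toLp_add]
    refine MemLp.toLp_congr _ _ ?_
    filter_upwards [Lp.coeFn_add u v] with x hx
    rw [hx, Pi.add_apply, Pi.add_apply, mul_add]
  map_smul' c u := by
    rw [RingHom.id_apply, ← MemLp.toLp_const_smul]
    refine MemLp.toLp_congr _ _ ?_
    filter_upwards [Lp.coeFn_smul c u] with x hx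
    rw [hx, Pi.smul_apply, Pi.smul_apply, smul_eq_mul, smul_eq_mul]
    ring

/-- The operator `H = -d²/dx² + i sgn(x)` in `L²(ℝ)` with domain `W^{2,2}(ℝ)`. -/
def opH : L2R →ₗ.[ℂ] L2R where
  domain := W22
  toFun := -weakDeriv2 + Complex.I • (sgnMul ∘ₗ W22.subtype)

/-! ### Sesquilinear forms and the perturbed operator -/

/-- The form `h` of `H` on `W^{1,2}(ℝ)`, antilinear in the second argument. -/
def formH (ψ φ : W12) : ℂ :=
  (∫ x, weakDeriv ψ x * conj (weakDeriv φ x))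
    + Complex.I * (∫ x in Ioi (0 : ℝ), (ψ : L2R) x * conj ((φ : L2R) x))
    - Complex.I * (∫ x in Iio (0 : ℝ), (ψ : L2R) x * conj ((φ : L2R) x))

/-- The form `v` of the multiplication by `V` on `W^{1,2}(ℝ)`. For an integrable `V` the integrand
is integrable, see `integrable_formV`. -/
def formV (V : ℝ → ℂ) (ψ φ : W12) : ℂ :=
  ∫ x, V x * (ψ : L2R) x * conj ((φ : L2R) x)

/-- The form `h + ε v` on `W^{1,2}(ℝ)`. -/
def formPert (V : ℝ → ℂ) (ε : ℝ) (ψ φ : W12) : ℂ :=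
  formH ψ φ + (ε : ℂ) * formV V ψ φ

lemma integrable_normSq (u : L2R) : Integrable (fun x => ‖u x‖ ^ 2) volume :=
  (Lp.memLp u).integrable_norm_pow (by norm_num)

/-- Two averages of a Sobolev function over the same interval differ by a bounded amount. -/
lemma norm_integral_sub_le {u w : L2R} (h : HasWeakDeriv u w) (x : ℝ) {a b : ℝ → ℝ}
    (ha : ContDiff ℝ ∞ a) (hb : ContDiff ℝ ∞ b) (ha0 : ∀ t, 0 ≤ a t) (hb0 : ∀ t, 0 ≤ b t)
    (ha1 : ∫ t, a t = 1) (hb1 : ∫ t, b t = 1)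
    (has : ∀ t, t ∉ Icc (x - 1) (x + 1) → a t = 0)
    (hbs : ∀ t, t ∉ Icc (x - 1) (x + 1) → b t = 0) :
    ‖(∫ t, a t • u t) - ∫ t, b t • u t‖ ≤ 4 + 2 * ∫ t, ‖w t‖ ^ 2 := by
  have hac : HasCompactSupport a := HasCompactSupport.intro isCompact_Icc has
  have hbc : HasCompactSupport b := HasCompactSupport.intro isCompact_Icc hbs
  have hai : Integrable a volume := ha.continuous.integrable_of_hasCompactSupport hac
  have hbi : Integrable b volume := hb.continuous.integrable_of_hasCompactSupport hbc
  set d : ℝ → ℝ := fun t => a t - b t with hd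
  have hdc : ContDiff ℝ ∞ d := ha.sub hb
  have hds : ∀ t, t ∉ Icc (x - 1) (x + 1) → d t = 0 := fun t ht => by
    simp only [hd, has t ht, hbs t ht, sub_zero]
  have hdi : Integrable d volume := hai.sub hbi
  have hd0 : ∫ t, d t = 0 := by
    rw [hd, integral_sub hai hbi, ha1, hb1, sub_self]
  set Φ : ℝ → ℝ := fun t => ∫ s in (x - 2)..t, d s with hΦ
  have hder : ∀ t, HasDerivAt Φ (d t) t := fun t =>
    intervalIntegral.integral_hasDerivAt_right hdi.intervalIntegrable
      hdc.continuous.aestronglyMeasurable.stronglyMeasurableAtFilter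
      hdc.continuous.continuousAt
  have hderiv : deriv Φ = d := funext fun t => (hder t).deriv
  have hΦc : ContDiff ℝ ∞ Φ := by
    rw [contDiff_infty_iff_deriv]
    exact ⟨fun t => (hder t).differentiableAt, by rw [hderiv]; exact hdc⟩
  have hΦs : ∀ t, t ∉ Icc (x - 1) (x + 1) → Φ t = 0 := by
    intro t ht
    rcases lt_or_ge t (x - 1) with h1 | h1
    · have : ∀ s ∈ uIcc (x - 2) t, d s = 0 := by
        intro s hs
        apply hds
        rintro ⟨h2, _⟩
        have := hs.2
        have h3 : max (x - 2) t < x - 1 := max_lt (by linarith) h1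
        linarith
      simp only [hΦ]
      rw [intervalIntegral.integral_congr this]
      simp
    · have h2 : x + 1 < t := by
        by_contra h3
        exact ht ⟨h1, not_lt.mp h3⟩
      simp only [hΦ]
      rw [intervalIntegral.integral_eq_integral_of_support_subset, hd0]
      intro s hs
      by_contra h3
      apply hs
      apply hds
      rintro ⟨h4, h5⟩
      exact h3 ⟨by linarith, by linarith⟩
  have hΦcs : HasCompactSupport Φ := HasCompactSupport.intro isCompact_Icc hΦs
  have hΦb : ∀ t, |Φ t| ≤ 2 := by
    intro t
    calc |Φ t| ≤ ∫ s in uIoc (x - 2) t, ‖d s‖ := by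
          rw [← Real.norm_eq_abs]
          exact intervalIntegral.norm_integral_le_integral_norm_uIoc
      _ ≤ ∫ s, ‖d s‖ := setIntegral_le_integral hdi.norm (ae_of_all _ fun _ => norm_nonneg _)
      _ ≤ ∫ s, (a s + b s) := by
          refine integral_mono hdi.norm (hai.add hbi) fun s => ?_
          simp only [hd, Real.norm_eq_abs]
          rw [abs_le]
          constructor <;> linarith [ha0 s, hb0 s]
      _ = 2 := by rw [integral_add hai hbi, ha1, hb1]; norm_num
  have key := h Φ hΦc hΦcs
  rw [hderiv] at key
  have e1 : (∫ t, a t • u t) - ∫ t, b t • u t = -∫ t, Φ t • w t := by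
    rw [← key, ← integral_sub (integrable_test_smul ha.continuous hac u)
      (integrable_test_smul hb.continuous hbc u)]
    simp only [hd, sub_smul]
  rw [e1, norm_neg]
  have hI : Integrable ((Icc (x - 1) (x + 1)).indicator fun _ : ℝ => (2 : ℝ)) volume :=
    (integrable_indicator_iff measurableSet_Icc).mpr (integrableOn_const (by simp))
  calc ‖∫ t, Φ t • w t‖
      ≤ ∫ t, ((Icc (x - 1) (x + 1)).indicator (fun _ => (2 : ℝ)) t + 2 * ‖w t‖ ^ 2) := by
        refine norm_integral_le_of_norm_le (hI.add ((integrable_normSq w).const_mul 2))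
          (ae_of_all _ fun t => ?_)
        rw [norm_smul, Real.norm_eq_abs]
        by_cases ht : t ∈ Icc (x - 1) (x + 1)
        · rw [indicator_of_mem ht]
          nlinarith [hΦb t, norm_nonneg (w t), sq_nonneg (‖w t‖ - 1), sq_nonneg (‖w t‖)]
        · rw [indicator_of_notMem ht, hΦs t ht, abs_zero, zero_mul]
          positivity
    _ = 4 + 2 * ∫ t, ‖w t‖ ^ 2 := by
        rw [integral_add hI ((integrable_normSq w).const_mul 2), integral_const_mul,
          integral_indicator measurableSet_Icc]
        simp
        norm_num

/-- Functions in `W^{1,2}(ℝ)` are essentially bounded. -/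
lemma exists_ae_bound (u : W12) : ∃ C : ℝ, ∀ᵐ x, ‖(u : L2R) x‖ ≤ C := by
  obtain ⟨u, w, h⟩ := u
  let β : ℕ → ContDiffBump (0 : ℝ) := fun n =>
    ⟨1 / (2 * ((n : ℝ) + 1)), 1 / ((n : ℝ) + 1), by positivity, by
      apply one_div_lt_one_div_of_lt <;> linarith [Nat.cast_nonneg (α := ℝ) n]⟩
  have hout : ∀ n, (β n).rOut = 1 / ((n : ℝ) + 1) := fun n => rfl
  have hout1 : ∀ n, (β n).rOut ≤ 1 := fun n => by
    rw [hout, div_le_one (by positivity)]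
    linarith [Nat.cast_nonneg (α := ℝ) n]
  have hlim : Tendsto (fun n => (β n).rOut) atTop (𝓝 0) := tendsto_one_div_add_atTop_nhds_zero_nat
  have hrat : ∀ᶠ n in atTop, (β n).rOut ≤ 2 * (β n).rIn := by
    refine Eventually.of_forall fun n => ?_
    change 1 / ((n : ℝ) + 1) ≤ 2 * (1 / (2 * ((n : ℝ) + 1)))
    apply le_of_eq
    field_simp
  have hae := ContDiffBump.ae_convolution_tendsto_right_of_locallyIntegrable
    (μ := (volume : Measure ℝ)) hlim hrat (locInt u)
  set ρ : ℝ → ℝ := (β 0).normed volume with hρ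
  have hρi : Integrable (fun t => ρ t ^ 2) volume := by
    have h1 : Continuous fun t => ρ t ^ 2 := ((β 0).continuous_normed).pow 2
    refine h1.integrable_of_hasCompactSupport ?_
    exact ((β 0).hasCompactSupport_normed (μ := volume)).comp_left (g := fun y => y ^ 2) (by simp)
  set C : ℝ := (4 + 2 * ∫ t, ‖w t‖ ^ 2) + ((∫ t, ρ t ^ 2) + ∫ t, ‖u t‖ ^ 2) with hC
  refine ⟨C, ?_⟩
  filter_upwards [hae] with x hx
  refine le_of_tendsto hx.norm (Eventually.of_forall fun n => ?_)
  rw [convolution_eq_swap]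
  simp only [ContinuousLinearMap.lsmul_apply]
  have hsupp : ∀ m, ∀ t, t ∉ Icc (x - 1) (x + 1) → (β m).normed volume (x - t) = 0 := by
    intro m t ht
    by_contra h0
    have h1 : x - t ∈ Metric.ball (0 : ℝ) (β m).rOut := by
      rw [← (β m).support_normed_eq (μ := volume)]
      exact h0
    rw [Metric.mem_ball, dist_zero_right, Real.norm_eq_abs, abs_lt] at h1
    have := hout1 m
    exact ht ⟨by linarith, by linarith⟩
  have hsm : ∀ m, ContDiff ℝ ∞ fun t => (β m).normed volume (x - t) := fun m =>
    ((β m).contDiff_normed).comp (contDiff_const.sub contDiff_id)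
  have hint : ∀ m, ∫ t, (β m).normed volume (x - t) = 1 := fun m => by
    rw [integral_sub_left_eq_self (fun t => (β m).normed volume t) volume x]
    exact (β m).integral_normed
  have h1 := norm_integral_sub_le h x (hsm n) (hsm 0) (fun t => (β n).nonneg_normed _)
    (fun t => (β 0).nonneg_normed _) (hint n) (hint 0) (hsupp n) (hsupp 0)
  have h2 : ‖∫ t, (β 0).normed volume (x - t) • u t‖ ≤ (∫ t, ρ t ^ 2) + ∫ t, ‖u t‖ ^ 2 := by
    rw [← integral_sub_left_eq_self (fun t => ρ t ^ 2) volume x,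
      ← integral_add (hρi.comp_sub_left x) (integrable_normSq u)]
    refine norm_integral_le_of_norm_le ((hρi.comp_sub_left x).add (integrable_normSq u))
      (ae_of_all _ fun t => ?_)
    rw [norm_smul, Real.norm_eq_abs, ← sq_abs (ρ (x - t))]
    nlinarith [sq_nonneg (|ρ (x - t)| - ‖u t‖), sq_nonneg (|ρ (x - t)|), sq_nonneg ‖u t‖]
  calc _ = ‖((∫ t, (β n).normed volume (x - t) • u t)
          - ∫ t, (β 0).normed volume (x - t) • u t)
          + ∫ t, (β 0).normed volume (x - t) • u t‖ := by rw [sub_add_cancel]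
    _ ≤ _ := (norm_add_le _ _).trans (add_le_add h1 h2)

lemma integrable_mul_conj (u v : L2R) : Integrable (fun x => u x * conj (v x)) volume := by
  have h := L2.integrable_inner (𝕜 := ℂ) v u
  refine h.congr (ae_of_all _ fun x => ?_)
  simp

/-- The integrand of the form of an integrable potential is integrable. -/
lemma integrable_formV {V : ℝ → ℂ} (hV : Integrable V) (ψ φ : W12) :
    Integrable (fun x => V x * (ψ : L2R) x * conj ((φ : L2R) x)) volume := by
  obtain ⟨C, hC⟩ := exists_ae_bound ψ
  obtain ⟨D, hD⟩ := exists_ae_bound φ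
  have h1 : Integrable (fun x => V x * (ψ : L2R) x) volume :=
    hV.mul_bdd (c := C) (Lp.aestronglyMeasurable _) hC
  refine h1.mul_bdd (c := D) ?_ ?_
  · exact Complex.continuous_conj.comp_aestronglyMeasurable (Lp.aestronglyMeasurable _)
  · filter_upwards [hD] with x hx
    rwa [RCLike.norm_conj]

lemma formV_add {V : ℝ → ℂ} (hV : Integrable V) (ψ ψ' φ : W12) :
    formV V (ψ + ψ') φ = formV V ψ φ + formV V ψ' φ := by
  unfold formV
  rw [← integral_add (integrable_formV hV ψ φ) (integrable_formV hV ψ' φ)]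
  refine integral_congr_ae ?_
  filter_upwards [Lp.coeFn_add (ψ : L2R) (ψ' : L2R)] with x hx
  rw [Submodule.coe_add, hx, Pi.add_apply]
  ring

lemma formV_smul (V : ℝ → ℂ) (c : ℂ) (ψ φ : W12) : formV V (c • ψ) φ = c * formV V ψ φ := by
  unfold formV
  rw [← integral_const_mul]
  refine integral_congr_ae ?_
  filter_upwards [Lp.coeFn_smul c (ψ : L2R)] with x hx
  rw [Submodule.coe_smul, hx, Pi.smul_apply, smul_eq_mul]
  ring

lemma setIntegral_mul_conj_add (s : Set ℝ) (u u' v : L2R) :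
    ∫ x in s, (u + u' : L2R) x * conj (v x)
      = (∫ x in s, u x * conj (v x)) + ∫ x in s, u' x * conj (v x) := by
  rw [← integral_add (integrable_mul_conj u v).integrableOn
    (integrable_mul_conj u' v).integrableOn]
  refine integral_congr_ae (ae_restrict_of_ae ?_)
  filter_upwards [Lp.coeFn_add u u'] with x hx
  rw [hx, Pi.add_apply, add_mul]

lemma setIntegral_mul_conj_smul (s : Set ℝ) (c : ℂ) (u v : L2R) :
    ∫ x in s, (c • u : L2R) x * conj (v x) = c * ∫ x in s, u x * conj (v x) := by
  rw [← integral_const_mul]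
  refine integral_congr_ae (ae_restrict_of_ae ?_)
  filter_upwards [Lp.coeFn_smul c u] with x hx
  rw [hx, Pi.smul_apply, smul_eq_mul, mul_assoc]

lemma formH_add (ψ ψ' φ : W12) : formH (ψ + ψ') φ = formH ψ φ + formH ψ' φ := by
  unfold formH
  have h := setIntegral_mul_conj_add univ (weakDeriv ψ) (weakDeriv ψ') (weakDeriv φ)
  simp only [setIntegral_univ] at h
  rw [map_add, Submodule.coe_add, h, setIntegral_mul_conj_add, setIntegral_mul_conj_add]
  ring

lemma formH_smul (c : ℂ) (ψ φ : W12) : formH (c • ψ) φ = c * formH ψ φ := by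
  unfold formH
  have h := setIntegral_mul_conj_smul univ c (weakDeriv ψ) (weakDeriv φ)
  simp only [setIntegral_univ] at h
  rw [map_smul, Submodule.coe_smul, h, setIntegral_mul_conj_smul, setIntegral_mul_conj_smul]
  ring

/-- The graph of the operator associated with the form `h + ε v`: the pairs `(ψ, η)` with
`ψ ∈ W^{1,2}(ℝ)`, `η ∈ L²(ℝ)` and `(h + ε v)(ψ, φ) = (η, φ)` for all `φ ∈ W^{1,2}(ℝ)`. -/
def graphPert (V : ℝ → ℂ) (hV : Integrable V) (ε : ℝ) : Submodule ℂ (L2R × L2R) where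
  carrier := {p | ∃ ψ : W12, (ψ : L2R) = p.1 ∧
    ∀ φ : W12, formPert V ε ψ φ = inner ℂ (φ : L2R) p.2}
  add_mem' := by
    rintro p p' ⟨ψ, h1, h2⟩ ⟨ψ', h1', h2'⟩
    refine ⟨ψ + ψ', by rw [Submodule.coe_add, h1, h1', Prod.fst_add], fun φ => ?_⟩
    rw [Prod.snd_add, inner_add_right, ← h2, ← h2']
    unfold formPert
    rw [formH_add, formV_add hV]
    ring
  zero_mem' := by
    refine ⟨0, rfl, fun φ => ?_⟩
    have h1 := formH_smul 0 0 φ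
    have h2 := formV_smul V 0 0 φ
    rw [zero_smul, zero_mul] at h1 h2
    unfold formPert
    rw [h1, h2, mul_zero, add_zero, Prod.snd_zero, inner_zero_right]
  smul_mem' := by
    rintro c p ⟨ψ, h1, h2⟩
    refine ⟨c • ψ, by rw [Submodule.coe_smul, h1, Prod.smul_fst], fun φ => ?_⟩
    rw [Prod.smul_snd, inner_smul_right, ← h2]
    unfold formPert
    rw [formH_smul, formV_smul]
    ring

/-- Smooth compactly supported functions belong to `W^{1,2}(ℝ)`. -/
lemma exists_W12_of_test {φ : ℝ → ℝ} (h1 : ContDiff ℝ ∞ φ) (h2 : HasCompactSupport φ) :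
    ∃ u : W12, (u : L2R) =ᵐ[volume] fun x => ((φ x : ℝ) : ℂ) := by
  have key : ∀ f : ℝ → ℝ, Continuous f → HasCompactSupport f →
      MemLp (fun x => ((f x : ℝ) : ℂ)) 2 (volume : Measure ℝ) := fun f hf hs =>
    (Complex.continuous_ofReal.comp hf).memLp_of_hasCompactSupport
      (hs.comp_left (g := Complex.ofReal) Complex.ofReal_zero)
  have hd := continuous_deriv_test h1
  refine ⟨⟨(key φ h1.continuous h2).toLp _, (key _ hd h2.deriv).toLp _, ?_⟩,
    MemLp.coeFn_toLp (key φ h1.continuous h2)⟩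
  intro χ c1 c2
  have e1 : ∫ x, deriv χ x • ((key φ h1.continuous h2).toLp _ : L2R) x
      = ((∫ x, deriv χ x * φ x : ℝ) : ℂ) := by
    rw [← integral_complex_ofReal]
    refine integral_congr_ae ?_
    filter_upwards [MemLp.coeFn_toLp (key φ h1.continuous h2)] with x hx
    rw [hx]
    simp
  have e2 : ∫ x, χ x • ((key _ hd h2.deriv).toLp _ : L2R) x
      = ((∫ x, χ x * deriv φ x : ℝ) : ℂ) := by
    rw [← integral_complex_ofReal]
    refine integral_congr_ae ?_
    filter_upwards [MemLp.coeFn_toLp (key _ hd h2.deriv)] with x hx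
    rw [hx]
    simp
  rw [e1, e2, ← Complex.ofReal_neg]
  congr 1
  have hdχ := continuous_deriv_test c1
  have := integral_mul_deriv_eq_deriv_mul_of_integrable (u := χ) (v := φ) (u' := deriv χ)
    (v' := deriv φ)
    (fun x _ => (c1.differentiable (by simp) x).hasDerivAt)
    (fun x _ => (h1.differentiable (by simp) x).hasDerivAt)
    ((c1.continuous.mul hd).integrable_of_hasCompactSupport c2.mul_right)
    ((hdχ.mul h1.continuous).integrable_of_hasCompactSupport h2.mul_left)
    ((c1.continuous.mul h1.continuous).integrable_of_hasCompactSupport c2.mul_right)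
  rw [this, neg_neg]

lemma eq_zero_of_inner_W12 {η : L2R} (h : ∀ φ : W12, inner ℂ (φ : L2R) η = 0) : η = 0 := by
  refine Lp.ext (EventuallyEq.trans (g := fun _ => (0 : ℂ))
    (ae_eq_zero_of_integral_contDiff_smul_eq_zero (locInt η) ?_) (Lp.coeFn_zero _ _ _).symm)
  intro φ h1 h2
  obtain ⟨u, hu⟩ := exists_W12_of_test h1 h2
  have := h u
  rw [L2.inner_def] at this
  rw [← this]
  refine integral_congr_ae ?_
  filter_upwards [hu] with x hx
  rw [hx]
  simp [mul_comm]

lemma graphPert_functional (V : ℝ → ℂ) (hV : Integrable V) (ε : ℝ) :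
    ∀ p ∈ graphPert V hV ε, p.1 = 0 → p.2 = 0 := by
  rintro p ⟨ψ, h1, h2⟩ h0
  refine eq_zero_of_inner_W12 fun φ => ?_
  have hψ : ψ = 0 := Subtype.ext (h1.trans h0)
  rw [← h2, hψ]
  have h3 := formH_smul 0 0 φ
  have h4 := formV_smul V 0 0 φ
  rw [zero_smul, zero_mul] at h3 h4
  unfold formPert
  rw [h3, h4, mul_zero, add_zero]

/-- The operator `H_ε` associated with the form `h + ε v` on `W^{1,2}(ℝ)`: its domain consists of
the `ψ ∈ W^{1,2}(ℝ)` for which there is `η ∈ L²(ℝ)` with `(h + ε v)(ψ, φ) = (η, φ)` for all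
`φ ∈ W^{1,2}(ℝ)`, and `H_ε ψ = η`. -/
def opPert (V : ℝ → ℂ) (hV : Integrable V) (ε : ℝ) : L2R →ₗ.[ℂ] L2R :=
  (graphPert V hV ε).toLinearPMap

lemma opPert_graph (V : ℝ → ℂ) (hV : Integrable V) (ε : ℝ) :
    (opPert V hV ε).graph = graphPert V hV ε :=
  Submodule.toLinearPMap_graph_eq _ (graphPert_functional V hV ε)

/-! ### The Birman-Schwinger operator -/

/-- The function `|V|^{1/2}`. -/
def absSqrt (V : ℝ → ℂ) (x : ℝ) : ℂ := ((Real.sqrt ‖V x‖ : ℝ) : ℂ)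

/-- The function `V_{1/2} = |V|^{1/2} e^{i arg V}`, so that `V = |V|^{1/2} V_{1/2}`. -/
def sgnSqrt (V : ℝ → ℂ) (x : ℝ) : ℂ := absSqrt V x * Complex.exp (Complex.I * Complex.arg (V x))

/-- `ψ ∈ W^{1,2}(ℝ)` is a weak solution of `(H - z) ψ = V_{1/2} g`, where `g ∈ L²(ℝ)` and where
`V_{1/2} g` is the element `φ ↦ ∫ V_{1/2} g φ̄` of `W^{-1,2}(ℝ)`. -/
def IsWeakSol (V : ℝ → ℂ) (z : ℂ) (g : L2R) (ψ : W12) : Prop :=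
  ∀ φ : W12, ∫ x, sgnSqrt V x * g x * conj ((φ : L2R) x)
    = formH ψ φ - z * inner ℂ (φ : L2R) (ψ : L2R)

/-- `K` is the bounded operator `|V|^{1/2} (H - z)⁻¹ V_{1/2}` in `L²(ℝ)`: for every `g ∈ L²(ℝ)` the
equation `(H - z) ψ = V_{1/2} g` has a unique weak solution `ψ = (H - z)⁻¹ V_{1/2} g` in
`W^{1,2}(ℝ)`, and `K g = |V|^{1/2} ψ`. -/
def IsBirmanSchwinger (V : ℝ → ℂ) (z : ℂ) (K : L2R →L[ℂ] L2R) : Prop :=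
  ∀ g : L2R, (∃! ψ : W12, IsWeakSol V z g ψ) ∧
    ∀ ψ : W12, IsWeakSol V z g ψ → K g =ᵐ[volume] fun x => absSqrt V x * (ψ : L2R) x

end BirmanSchwinger

end

noncomputable section

namespace BirmanSchwinger

/-! ### Hilbert-Schmidt operators are compact -/

section HilbertSchmidt

variable {E F : Type*} [NormedAddCommGroup E] [InnerProductSpace ℂ E]
  [NormedAddCommGroup F] [InnerProductSpace ℂ F]

/-! The form domain `W12` is treated as a Hilbert space, namely the graph of the weak derivative
with the norm of `L² × L²`. Write `A` and `B` for multiplication by `|V|^{1/2}` and by the conjugate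
of `V_{1/2}`, as maps from `W^{1,2}` to `L²`. Since `V_{1/2} g` is in general only a functional on
`W^{1,2}`, it is represented through Riesz by the vector `B* g`. If `T` solves `(H - z) ψ = k` for
functionals `k` represented in this way, then `K = A T B*`.

Solvability: a weak solution of the homogeneous equation lies in `W^{2,2}`, so `z ∉ σ(H)` forces it
to vanish (`eq_zero_of_formH`). Existence comes from correcting `k` by the resolvent applied to an
`L²` remainder (`exists_solution_operator`).

Hilbert–Schmidt: point evaluation on `W^{1,2}` is bounded uniformly in the point, so Bessel bounds
`∑ |e_j(x)|²` uniformly for orthonormal `e_j`. Integrating against `|m|²` shows that multiplication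
by an `L²` function `m` is Hilbert–Schmidt (`exists_sum_norm_mulGraph_sq_le`). This applies to `B`,
hence to `B*`, hence to `A T B*`.

Spectrum: because `V = V_{1/2} |V|^{1/2}`, the equation `(h + ε v)(ψ, ·) = z (ψ, ·)` says that `ψ`
solves `(H - z) ψ = V_{1/2} (-ε |V|^{1/2} ψ)`. So eigenfunctions `ψ` of `H_ε` correspond to
eigenvectors `g = |V|^{1/2} ψ` of `ε K` at `-1` (`mem_pointSpectrum_iff_exists`). As `ε K` is
compact, `-1` is in its spectrum exactly when it is an eigenvalue. -/

lemma hasSum_norm_inner_sq {κ : Type*} (e : HilbertBasis κ ℂ E) (x : E) :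
    HasSum (fun j => ‖inner ℂ (e j) x‖ ^ 2) (‖x‖ ^ 2) := by
  have h := (e.hasSum_inner_mul_inner x x).mapL Complex.reCLM
  have h2 : (inner ℂ x x : ℂ).re = ‖x‖ ^ 2 := inner_self_eq_norm_sq (𝕜 := ℂ) x
  convert h using 1
  · ext j
    simp only [Complex.reCLM_apply]
    rw [← inner_conj_symm x (e j), mul_comm, Complex.mul_conj, Complex.ofReal_re,
      Complex.normSq_eq_norm_sq]
  · exact h2.symm

variable [CompleteSpace E] [CompleteSpace F]

/-- The adjoint of a Hilbert-Schmidt operator is Hilbert-Schmidt. -/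
lemma sum_norm_adjoint_sq_le {κ ι : Type*} (B : E →L[ℂ] F) (e : HilbertBasis κ ℂ E) {C : ℝ}
    (hC : ∀ s : Finset κ, ∑ j ∈ s, ‖B (e j)‖ ^ 2 ≤ C) {b : ι → F} (hb : Orthonormal ℂ b)
    (s : Finset ι) : ∑ i ∈ s, ‖B.adjoint (b i)‖ ^ 2 ≤ C := by
  have h : HasSum (fun j => ∑ i ∈ s, ‖inner ℂ (e j) (B.adjoint (b i))‖ ^ 2)
      (∑ i ∈ s, ‖B.adjoint (b i)‖ ^ 2) :=
    hasSum_sum fun i _ => hasSum_norm_inner_sq e _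
  refine h.summable.hasSum.unique h ▸ h.summable.tsum_le_of_sum_le fun t => ?_
  -- Parseval in `e` has turned the sum into a double sum; for fixed `j`, Bessel for the system `b`
  -- bounds the inner sum by `‖B (e j)‖ ^ 2`.
  refine (Finset.sum_le_sum fun j _ => ?_).trans (hC t)
  refine le_trans (le_of_eq (Finset.sum_congr rfl fun i _ => ?_))
    (hb.sum_inner_products_le (B (e j)) (s := s))
  rw [ContinuousLinearMap.adjoint_inner_right, ← inner_conj_symm, RCLike.norm_conj]

/-- The finite-rank truncations of `K` along `b` converge to `K` in norm: the square of the error is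
at most the tail of the convergent series. -/
lemma isCompactOperator_of_summable {ι : Type*} (K : E →L[ℂ] F) (b : HilbertBasis ι ℂ E)
    (h : Summable fun i => ‖K (b i)‖ ^ 2) : IsCompactOperator K := by
  classical
  let P : Finset ι → E →L[ℂ] F := fun s =>
    ∑ i ∈ s, (ContinuousLinearMap.toSpanSingleton ℂ (K (b i))).comp (innerSL ℂ (b i))
  have hP : ∀ s x, P s x = ∑ i ∈ s, inner ℂ (b i) x • K (b i) := fun s x => by
    simp [P]
  have hcomp : ∀ s, IsCompactOperator (P s) := by
    intro s
    have : P s ∈ compactOperator (RingHom.id ℂ) E F := by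
      refine Submodule.sum_mem _ fun i _ => ?_
      exact (isCompactOperator_of_locallyCompactSpace_rng
        (ContinuousLinearMap.toSpanSingleton ℂ (K (b i)))).comp_clm _
    exact this
  have hdiff : ∀ s, ‖P s - K‖ ^ 2 ≤ ∑' i : {i // i ∉ s}, ‖K (b i)‖ ^ 2 := by
    intro s
    have h0 : 0 ≤ ∑' i : {i // i ∉ s}, ‖K (b i)‖ ^ 2 := tsum_nonneg fun _ => by positivity
    rw [← Real.sqrt_le_sqrt_iff h0, Real.sqrt_sq (norm_nonneg _)]
    -- The adjoint is easier to estimate: the coefficients of `(P s - K)* y` vanish on `s` and equal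
    -- `-⟨K (b i), y⟩` off `s`, so Parseval and Cauchy–Schwarz give the tail.
    rw [← (ContinuousLinearMap.adjoint (𝕜 := ℂ) (E := E) (F := F)).norm_map]
    refine ContinuousLinearMap.opNorm_le_bound _ (Real.sqrt_nonneg _) fun y => ?_
    rw [← Real.sqrt_sq (norm_nonneg y), ← Real.sqrt_mul h0]
    refine Real.le_sqrt_of_sq_le ?_
    set x := ContinuousLinearMap.adjoint (P s - K) y with hx
    have hin : ∀ i, inner ℂ (b i) x = if i ∈ s then 0 else - inner ℂ (K (b i)) y := by
      intro i
      rw [hx, ContinuousLinearMap.adjoint_inner_right, sub_apply, hP]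
      have : ∀ j, inner ℂ (b j) (b i) • K (b j) = if j = i then K (b i) else 0 := by
        intro j
        rw [orthonormal_iff_ite.mp b.orthonormal j i]
        split_ifs with hji
        · rw [hji, one_smul]
        · rw [zero_smul]
      simp only [this, Finset.sum_ite_eq']
      split_ifs <;> simp
    have h1 := hasSum_norm_inner_sq b x
    rw [← h1.tsum_eq, ← h1.summable.sum_add_tsum_subtype_compl s, ← tsum_mul_right]
    have h2 : ∑ i ∈ s, ‖inner ℂ (b i) x‖ ^ 2 = 0 :=
      Finset.sum_eq_zero fun i hi => by rw [hin, if_pos hi]; simp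
    rw [h2, zero_add]
    refine Summable.tsum_le_tsum (fun i => ?_) (h1.summable.subtype _)
      ((h.subtype _).mul_right _)
    rw [hin, if_neg i.2, norm_neg, ← mul_pow]
    exact pow_le_pow_left₀ (norm_nonneg _) (norm_inner_le_norm _ _) 2
  have ht : Tendsto (fun s => ‖P s - K‖ ^ 2) atTop (𝓝 0) :=
    squeeze_zero (fun _ => by positivity) hdiff
      (tendsto_tsum_compl_atTop_zero fun i => ‖K (b i)‖ ^ 2)
  refine isCompactOperator_of_tendsto (F := P) (l := atTop) ?_ (Eventually.of_forall hcomp)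
  rw [tendsto_iff_norm_sub_tendsto_zero]
  have := (Real.continuous_sqrt.tendsto 0).comp ht
  simpa [Function.comp_def, Real.sqrt_sq, norm_nonneg] using this

lemma IsHilbertSchmidt.isCompactOperator {E : Type} [NormedAddCommGroup E] [InnerProductSpace ℂ E]
    [CompleteSpace E] {K : E →L[ℂ] E} (hK : IsHilbertSchmidt K) : IsCompactOperator K := by
  obtain ⟨w, b, -⟩ := exists_hilbertBasis ℂ E
  exact isCompactOperator_of_summable K b (hK _ b)

end HilbertSchmidt

/-! ### Test functions as elements of `L²(ℝ)` -/

lemma memLp_test {φ : ℝ → ℝ} (h1 : Continuous φ) (h2 : HasCompactSupport φ) :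
    MemLp (fun x => ((φ x : ℝ) : ℂ)) 2 (volume : Measure ℝ) :=
  (Complex.continuous_ofReal.comp h1).memLp_of_hasCompactSupport
    (h2.comp_left (g := Complex.ofReal) Complex.ofReal_zero)

/-- A continuous compactly supported function, as an element of `L²(ℝ)`. -/
def testL2 (φ : ℝ → ℝ) (h1 : Continuous φ) (h2 : HasCompactSupport φ) : L2R :=
  (memLp_test h1 h2).toLp _

lemma coeFn_testL2 {φ : ℝ → ℝ} (h1 : Continuous φ) (h2 : HasCompactSupport φ) :
    testL2 φ h1 h2 =ᵐ[volume] fun x => ((φ x : ℝ) : ℂ) :=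
  MemLp.coeFn_toLp _

lemma inner_testL2 {φ : ℝ → ℝ} (h1 : Continuous φ) (h2 : HasCompactSupport φ) (u : L2R) :
    inner ℂ (testL2 φ h1 h2) u = ∫ x, φ x • u x := by
  rw [L2.inner_def]
  refine integral_congr_ae ?_
  filter_upwards [coeFn_testL2 h1 h2] with x hx
  rw [hx]
  simp [mul_comm]

lemma hasWeakDeriv_testL2 {φ : ℝ → ℝ} (h1 : ContDiff ℝ ∞ φ) (h2 : HasCompactSupport φ) :
    HasWeakDeriv (testL2 φ h1.continuous h2)
      (testL2 (deriv φ) (continuous_deriv_test h1) h2.deriv) := by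
  intro χ c1 c2
  have e1 : ∫ x, deriv χ x • (testL2 φ h1.continuous h2) x
      = ((∫ x, deriv χ x * φ x : ℝ) : ℂ) := by
    rw [← integral_complex_ofReal]
    refine integral_congr_ae ?_
    filter_upwards [coeFn_testL2 h1.continuous h2] with x hx
    rw [hx]
    simp
  have e2 : ∫ x, χ x • (testL2 (deriv φ) (continuous_deriv_test h1) h2.deriv) x
      = ((∫ x, χ x * deriv φ x : ℝ) : ℂ) := by
    rw [← integral_complex_ofReal]
    refine integral_congr_ae ?_
    filter_upwards [coeFn_testL2 (continuous_deriv_test h1) h2.deriv] with x hx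
    rw [hx]
    simp
  rw [e1, e2, ← Complex.ofReal_neg]
  congr 1
  have hdχ := continuous_deriv_test c1
  have := integral_mul_deriv_eq_deriv_mul_of_integrable (u := χ) (v := φ) (u' := deriv χ)
    (v' := deriv φ)
    (fun x _ => (c1.differentiable (by simp) x).hasDerivAt)
    (fun x _ => (h1.differentiable (by simp) x).hasDerivAt)
    ((c1.continuous.mul (continuous_deriv_test h1)).integrable_of_hasCompactSupport c2.mul_right)
    ((hdχ.mul h1.continuous).integrable_of_hasCompactSupport h2.mul_left)
    ((c1.continuous.mul h1.continuous).integrable_of_hasCompactSupport c2.mul_right)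
  rw [this, neg_neg]

/-- Test functions are real, so no conjugate appears. In this form the relation is a family of
closed linear conditions on the pair `(u, w)`, which makes the graph complete. -/
lemma hasWeakDeriv_iff_inner {u w : L2R} : HasWeakDeriv u w ↔
    ∀ (φ : ℝ → ℝ) (h1 : ContDiff ℝ ∞ φ) (h2 : HasCompactSupport φ),
      inner ℂ (testL2 (deriv φ) (continuous_deriv_test h1) h2.deriv) u
        = -inner ℂ (testL2 φ h1.continuous h2) w := by
  simp only [inner_testL2]
  rfl

/-! ### The Sobolev space as a Hilbert space -/

/-- The Sobolev space `W^{1,2}(ℝ)` with its Hilbert space structure, as the graph of the weak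
derivative. -/
def W12Graph : Submodule ℂ (WithLp 2 (L2R × L2R)) where
  carrier := {p | HasWeakDeriv p.fst p.snd}
  add_mem' := fun h h' => HasWeakDeriv.add h h'
  zero_mem' := hasWeakDeriv_iff_inner.mpr fun _ _ _ => by simp
  smul_mem' := fun c _ h => HasWeakDeriv.smul c h

lemma mem_W12Graph {p : WithLp 2 (L2R × L2R)} : p ∈ W12Graph ↔ HasWeakDeriv p.fst p.snd := Iff.rfl

lemma isClosed_W12Graph : IsClosed (W12Graph : Set (WithLp 2 (L2R × L2R))) := by
  have : (W12Graph : Set (WithLp 2 (L2R × L2R))) =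
      ⋂ (φ : ℝ → ℝ) (h1 : ContDiff ℝ ∞ φ) (h2 : HasCompactSupport φ),
        {p | inner ℂ (testL2 (deriv φ) (continuous_deriv_test h1) h2.deriv) p.fst
          = -inner ℂ (testL2 φ h1.continuous h2) p.snd} := by
    ext p
    simp only [SetLike.mem_coe, mem_W12Graph, hasWeakDeriv_iff_inner, mem_iInter, mem_ofPred_eq]
  rw [this]
  refine isClosed_iInter fun φ => isClosed_iInter fun h1 => isClosed_iInter fun h2 => ?_
  exact isClosed_eq (continuous_const.inner (WithLp.continuous_fst 2 L2R L2R))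
    (continuous_const.inner (WithLp.continuous_snd 2 L2R L2R)).neg

instance : CompleteSpace W12Graph := isClosed_W12Graph.completeSpace_coe

/-- The identification of `W^{1,2}(ℝ)` with the graph of the weak derivative. -/
def graphEquiv : W12 ≃ₗ[ℂ] W12Graph where
  toFun ψ := ⟨WithLp.toLp 2 ((ψ : L2R), weakDeriv ψ), hasWeakDeriv_weakDeriv ψ⟩
  map_add' ψ φ := by
    ext1
    simp only [map_add, Submodule.coe_add]
    rfl
  map_smul' c ψ := by
    ext1
    simp only [map_smul, Submodule.coe_smul]
    rfl
  invFun u := ⟨(u : WithLp 2 (L2R × L2R)).fst, _, u.2⟩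
  left_inv ψ := rfl
  right_inv u := by
    have h : weakDeriv ⟨(u : WithLp 2 (L2R × L2R)).fst, _, u.2⟩
      = (u : WithLp 2 (L2R × L2R)).snd := (hasWeakDeriv_weakDeriv _).unique u.2
    ext1
    change WithLp.toLp 2 (_, weakDeriv _) = _
    rw [h]
    rfl

@[simp] lemma graphEquiv_fst (ψ : W12) :
    (graphEquiv ψ : WithLp 2 (L2R × L2R)).fst = (ψ : L2R) := rfl

@[simp] lemma graphEquiv_snd (ψ : W12) :
    (graphEquiv ψ : WithLp 2 (L2R × L2R)).snd = weakDeriv ψ := rfl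

@[simp] lemma coe_graphEquiv_symm (u : W12Graph) :
    (graphEquiv.symm u : L2R) = (u : WithLp 2 (L2R × L2R)).fst := rfl

lemma W12Graph_inner (u v : W12Graph) : inner ℂ u v
    = inner ℂ (u : WithLp 2 (L2R × L2R)).fst (v : WithLp 2 (L2R × L2R)).fst
      + inner ℂ (u : WithLp 2 (L2R × L2R)).snd (v : WithLp 2 (L2R × L2R)).snd := by
  rw [Submodule.coe_inner, WithLp.prod_inner_apply]
  rfl

lemma W12Graph_norm_sq (u : W12Graph) : ‖u‖ ^ 2
    = ‖(u : WithLp 2 (L2R × L2R)).fst‖ ^ 2 + ‖(u : WithLp 2 (L2R × L2R)).snd‖ ^ 2 := by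
  rw [Submodule.coe_norm, WithLp.prod_norm_sq_eq_of_L2]

/-- The continuous embedding of `W^{1,2}(ℝ)` into `L²(ℝ)`. -/
def graphFst : W12Graph →L[ℂ] L2R where
  toFun u := (u : WithLp 2 (L2R × L2R)).fst
  map_add' _ _ := rfl
  map_smul' _ _ := rfl
  cont := (WithLp.continuous_fst 2 L2R L2R).comp continuous_subtype_val

@[simp] lemma graphFst_apply (u : W12Graph) :
    graphFst u = (u : WithLp 2 (L2R × L2R)).fst := rfl

/-- The weak derivative as a continuous map from `W^{1,2}(ℝ)` to `L²(ℝ)`. -/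
def graphSnd : W12Graph →L[ℂ] L2R where
  toFun u := (u : WithLp 2 (L2R × L2R)).snd
  map_add' _ _ := rfl
  map_smul' _ _ := rfl
  cont := (WithLp.continuous_snd 2 L2R L2R).comp continuous_subtype_val

@[simp] lemma graphSnd_apply (u : W12Graph) :
    graphSnd u = (u : WithLp 2 (L2R × L2R)).snd := rfl

lemma graphFst_injective : Function.Injective graphFst := fun u v h => by
  apply graphEquiv.symm.injective
  exact Subtype.ext h

/-! ### Density of the test functions -/

/-- The test functions, as elements of `W^{1,2}(ℝ)`. -/
def testGraph (φ : ℝ → ℝ) (h1 : ContDiff ℝ ∞ φ) (h2 : HasCompactSupport φ) : W12Graph :=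
  ⟨WithLp.toLp 2 (testL2 φ h1.continuous h2,
    testL2 (deriv φ) (continuous_deriv_test h1) h2.deriv), hasWeakDeriv_testL2 h1 h2⟩

/-- A locally integrable function with vanishing weak derivative is constant. -/
lemma ae_eq_const_of_integral_deriv_smul_eq_zero {f : ℝ → ℂ} (hf : LocallyIntegrable f volume)
    (h : ∀ φ : ℝ → ℝ, ContDiff ℝ ∞ φ → HasCompactSupport φ → ∫ x, deriv φ x • f x = 0) :
    ∃ c : ℂ, f =ᵐ[volume] fun _ => c := by
  let β : ContDiffBump (0 : ℝ) := ⟨1, 2, one_pos, one_lt_two⟩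
  set ρ : ℝ → ℝ := β.normed volume with hρ
  have hρc : ContDiff ℝ ∞ ρ := β.contDiff_normed
  have hρs : HasCompactSupport ρ := β.hasCompactSupport_normed
  have hρi : Integrable ρ := hρc.continuous.integrable_of_hasCompactSupport hρs
  have hρ1 : ∫ x, ρ x = 1 := β.integral_normed
  refine ⟨∫ x, ρ x • f x, ae_eq_of_integral_contDiff_smul_eq hf
    (continuous_const.locallyIntegrable) fun φ h1 h2 => ?_⟩
  have hφi : Integrable φ := h1.continuous.integrable_of_hasCompactSupport h2
  set m : ℝ := ∫ x, φ x with hm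
  -- Subtracting `m ρ` makes the integral zero, so the primitive of `d` is again a test function and
  -- `d` is an admissible derivative in `h`.
  set d : ℝ → ℝ := fun t => φ t - m * ρ t with hd
  have hdc : ContDiff ℝ ∞ d := h1.sub (contDiff_const.mul hρc)
  have hds : HasCompactSupport d := h2.sub hρs.mul_left
  have hdi : Integrable d := hφi.sub (hρi.const_mul m)
  have hd0 : ∫ t, d t = 0 := by
    rw [hd, integral_sub hφi (hρi.const_mul m), integral_const_mul, hρ1, mul_one, sub_self]
  obtain ⟨r, hr⟩ := hds.isCompact.isBounded.subset_closedBall (0 : ℝ)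
  have hdz : ∀ t, r < |t| → d t = 0 := fun t ht => by
    by_contra h0
    have := hr (subset_tsupport _ h0)
    rw [Metric.mem_closedBall, dist_zero_right, Real.norm_eq_abs] at this
    linarith
  set Φ : ℝ → ℝ := fun t => ∫ s in (-(|r| + 1))..t, d s with hΦ
  have hder : ∀ t, HasDerivAt Φ (d t) t := fun t =>
    intervalIntegral.integral_hasDerivAt_right hdi.intervalIntegrable
      hdc.continuous.aestronglyMeasurable.stronglyMeasurableAtFilter
      hdc.continuous.continuousAt
  have hderiv : deriv Φ = d := funext fun t => (hder t).deriv
  have hΦc : ContDiff ℝ ∞ Φ := by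
    rw [contDiff_infty_iff_deriv]
    exact ⟨fun t => (hder t).differentiableAt, by rw [hderiv]; exact hdc⟩
  have hΦs : ∀ t, t ∉ Icc (-(|r| + 1)) (|r| + 1) → Φ t = 0 := by
    intro t ht
    rcases lt_or_ge t (-(|r| + 1)) with h3 | h3
    · have : ∀ s ∈ uIcc (-(|r| + 1)) t, d s = 0 := by
        intro s hs
        apply hdz
        rw [uIcc_of_ge h3.le] at hs
        have := neg_le_abs s
        linarith [hs.2, le_abs_self r]
      simp only [hΦ]
      rw [intervalIntegral.integral_congr this]
      simp
    · have h4 : |r| + 1 < t := by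
        by_contra h5
        exact ht ⟨h3, not_lt.mp h5⟩
      simp only [hΦ]
      rw [intervalIntegral.integral_eq_integral_of_support_subset, hd0]
      intro s hs
      have h5 : |s| ≤ r := not_lt.mp fun h6 => hs (hdz s h6)
      have h6 := abs_le.mp h5
      exact ⟨by linarith [le_abs_self r], by linarith [le_abs_self r]⟩
  have key := h Φ hΦc (HasCompactSupport.intro isCompact_Icc hΦs)
  rw [hderiv] at key
  have i1 : Integrable (fun x => φ x • f x) :=
    hf.integrable_smul_left_of_hasCompactSupport h1.continuous h2
  have i2 : Integrable (fun x => ρ x • f x) :=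
    hf.integrable_smul_left_of_hasCompactSupport hρc.continuous hρs
  have : ∫ x, d x • f x = (∫ x, φ x • f x) - m • ∫ x, ρ x • f x := by
    have i3 : Integrable (fun x => m • ρ x • f x) := i2.smul m
    rw [← integral_smul, ← integral_sub i1 i3]
    simp only [hd, sub_smul, mul_smul]
  rw [key] at this
  rw [integral_smul_const, ← hm]
  exact (sub_eq_zero.mp this.symm)

lemma not_integrable_exp_mul {a : ℝ} (ha : a ≠ 0) :
    ¬ Integrable (fun x : ℝ => Real.exp (a * x)) volume := by
  intro h
  rcases lt_or_gt_of_ne ha with h0 | h0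
  · have h1 : Integrable (fun _ : ℝ => (1 : ℝ)) (volume.restrict (Iic 0)) := by
      refine Integrable.mono' h.integrableOn aestronglyMeasurable_const ?_
      filter_upwards [ae_restrict_mem measurableSet_Iic] with x hx
      rw [norm_one]
      exact Real.one_le_exp (mul_nonneg_of_nonpos_of_nonpos h0.le hx)
    rw [integrable_const_iff] at h1
    simp [isFiniteMeasure_iff] at h1
  · have h1 : Integrable (fun _ : ℝ => (1 : ℝ)) (volume.restrict (Ici 0)) := by
      refine Integrable.mono' h.integrableOn aestronglyMeasurable_const ?_
      filter_upwards [ae_restrict_mem measurableSet_Ici] with x hx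
      rw [norm_one]
      exact Real.one_le_exp (mul_nonneg h0.le hx)
    rw [integrable_const_iff] at h1
    simp [isFiniteMeasure_iff] at h1

/-- A square integrable weak solution of `u' = a u` with real `a ≠ 0` vanishes. -/
lemma eq_zero_of_hasWeakDeriv_smul {a : ℝ} (ha : a ≠ 0) {u : L2R}
    (h : HasWeakDeriv u ((a : ℂ) • u)) : u = 0 := by
  have hexp : ContDiff ℝ ∞ fun x : ℝ => Real.exp (-(a * x)) :=
    Real.contDiff_exp.comp (contDiff_const.mul contDiff_id).neg
  have hloc : LocallyIntegrable (fun x => Real.exp (-(a * x)) • u x) volume :=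
    (locInt u).continuous_smul hexp.continuous
  -- Integrating factor: `e^{-ax} u` has zero weak derivative, so `u = c e^{ax}`, which is square
  -- integrable only for `c = 0`.
  obtain ⟨c, hc⟩ := ae_eq_const_of_integral_deriv_smul_eq_zero hloc (by
    intro φ h1 h2
    have hχ : ContDiff ℝ ∞ fun x => φ x * Real.exp (-(a * x)) := h1.mul hexp
    have hχs : HasCompactSupport fun x => φ x * Real.exp (-(a * x)) := h2.mul_right
    have key := h _ hχ hχs
    rw [integral_test_smul] at key
    have hd : ∀ x, deriv (fun x => φ x * Real.exp (-(a * x))) x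
        = deriv φ x * Real.exp (-(a * x)) - a * (φ x * Real.exp (-(a * x))) := by
      intro x
      have e1 : HasDerivAt (fun x : ℝ => Real.exp (-(a * x))) (Real.exp (-(a * x)) * (-(a * 1))) x :=
        (((hasDerivAt_id x).const_mul a).neg).exp
      refine (((h1.differentiable (by simp) x).hasDerivAt).mul e1).deriv.trans ?_
      ring
    simp only [hd, sub_smul] at key
    have i1 : Integrable fun x => (deriv φ x * Real.exp (-(a * x))) • u x :=
      integrable_test_smul ((continuous_deriv_test h1).mul hexp.continuous) h2.deriv.mul_right u
    have i2 : Integrable fun x => (φ x * Real.exp (-(a * x))) • u x :=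
      integrable_test_smul hχ.continuous hχs u
    have i4 : Integrable fun x => (a * (φ x * Real.exp (-(a * x)))) • u x :=
      (i2.smul a).congr (ae_of_all _ fun x => by simp only [Pi.smul_apply, mul_smul])
    have i3 : ∫ x, (a * (φ x * Real.exp (-(a * x)))) • u x
        = (a : ℂ) * ∫ x, (φ x * Real.exp (-(a * x))) • u x := by
      rw [← integral_const_mul]
      congr 1
      ext x
      simp only [Complex.real_smul]
      push_cast
      ring
    rw [integral_sub i1 i4, i3] at key
    simp only [← mul_smul]
    linear_combination key)
  have hu : ∀ᵐ x, u x = Real.exp (a * x) • c := by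
    filter_upwards [hc] with x hx
    rw [← hx, ← mul_smul, ← Real.exp_add, add_neg_cancel, Real.exp_zero, one_smul]
  have hc0 : c = 0 := by
    by_contra h0
    apply not_integrable_exp_mul (mul_ne_zero two_ne_zero ha)
    have := (integrable_normSq u).const_mul ((‖c‖ ^ 2)⁻¹)
    refine this.congr ?_
    filter_upwards [hu] with x hx
    rw [hx, norm_smul, mul_pow, Real.norm_eq_abs, sq_abs, ← Real.exp_nat_mul]
    have : ‖c‖ ≠ 0 := norm_ne_zero_iff.mpr h0
    field_simp
    congr 1
    push_cast
    ring
  refine Lp.ext ?_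
  filter_upwards [hu, Lp.coeFn_zero ℂ 2 (volume : Measure ℝ)] with x hx hx0
  rw [hx, hx0, hc0]
  simp

/-- The test functions are total in `W^{1,2}(ℝ)`. -/
lemma eq_zero_of_forall_inner_testGraph {v : W12Graph}
    (h : ∀ φ h1 h2, inner ℂ (testGraph φ h1 h2) v = 0) : v = 0 := by
  -- Orthogonality to all test functions in the graph inner product is the weak equation `v'' = v`.
  have h1 : HasWeakDeriv (graphSnd v) (graphFst v) := by
    rw [hasWeakDeriv_iff_inner]
    intro φ h1 h2
    have := h φ h1 h2
    rw [W12Graph_inner] at this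
    rw [eq_neg_iff_add_eq_zero, add_comm]
    exact this
  have h0 : HasWeakDeriv (graphFst v) (graphSnd v) := v.2
  -- The sum `v + v'` is its own derivative, hence zero; what remains is `v' = -v`, whose only
  -- solution in `L²` is zero.
  have h2 : graphFst v + graphSnd v = 0 := by
    refine eq_zero_of_hasWeakDeriv_smul one_ne_zero ?_
    have := h0.add h1
    rw [add_comm (graphSnd v) (graphFst v)] at this
    rwa [Complex.ofReal_one, one_smul]
  have h3 : graphFst v = 0 := by
    refine eq_zero_of_hasWeakDeriv_smul (a := -1) (by norm_num) ?_
    rw [Complex.ofReal_neg, Complex.ofReal_one, neg_smul, one_smul,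
      ← eq_neg_of_add_eq_zero_right h2]
    exact h0
  exact graphFst_injective (h3.trans (map_zero _).symm)

/-- Integration by parts in `W^{1,2}(ℝ)`. -/
lemma HasWeakDeriv.inner_graphSnd {a b : L2R} (h : HasWeakDeriv a b) (φ : W12Graph) :
    inner ℂ (graphSnd φ) a = -inner ℂ (graphFst φ) b := by
  -- The hypothesis says that this vector is orthogonal to the test functions, which are total.
  have : graphSnd.adjoint a + graphFst.adjoint b = 0 := by
    refine eq_zero_of_forall_inner_testGraph fun φ h1 h2 => ?_
    rw [inner_add_right, ContinuousLinearMap.adjoint_inner_right,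
      ContinuousLinearMap.adjoint_inner_right, add_eq_zero_iff_eq_neg]
    exact hasWeakDeriv_iff_inner.mp h φ h1 h2
  rw [← ContinuousLinearMap.adjoint_inner_right, eq_neg_of_add_eq_zero_left this, inner_neg_right,
    ContinuousLinearMap.adjoint_inner_right]

/-! ### Pointwise bounds for orthonormal systems in `W^{1,2}(ℝ)` -/

lemma integral_normSq (u : L2R) : ∫ x, ‖u x‖ ^ 2 = ‖u‖ ^ 2 := by
  have h := inner_self_eq_norm_sq_to_K (𝕜 := ℂ) u
  rw [L2.inner_def] at h
  have h2 : ∀ x, inner ℂ (u x) (u x) = ((‖u x‖ ^ 2 : ℝ) : ℂ) := fun x => by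
    rw [inner_self_eq_norm_sq_to_K (𝕜 := ℂ)]
    push_cast
    rfl
  simp only [h2] at h
  rw [integral_complex_ofReal] at h
  refine Complex.ofReal_injective (h.trans ?_)
  push_cast
  rfl

/-- Mollified point evaluations are bounded on `W^{1,2}(ℝ)`, uniformly in the point and in the
mollification parameter. -/
lemma exists_mollified_eval : ∃ C : ℝ, 0 ≤ C ∧ ∃ δ : ℕ → ℝ → W12Graph →L[ℂ] ℂ,
    (∀ n x, ‖δ n x‖ ≤ C) ∧
    ∀ u, ∀ᵐ x, Tendsto (fun n => δ n x u) atTop (𝓝 (graphFst u x)) := by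
  -- Outer radius at most 1 keeps every mollifier inside `[x - 1, x + 1]`; the ratio 2 of the radii
  -- meets the condition for almost everywhere convergence.
  let β : ℕ → ContDiffBump (0 : ℝ) := fun n =>
    ⟨1 / (2 * ((n : ℝ) + 1)), 1 / ((n : ℝ) + 1), by positivity, by
      apply one_div_lt_one_div_of_lt <;> linarith [Nat.cast_nonneg (α := ℝ) n]⟩
  have hout : ∀ n, (β n).rOut = 1 / ((n : ℝ) + 1) := fun n => rfl
  have hout1 : ∀ n, (β n).rOut ≤ 1 := fun n => by
    rw [hout, div_le_one (by positivity)]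
    linarith [Nat.cast_nonneg (α := ℝ) n]
  have hlim : Tendsto (fun n => (β n).rOut) atTop (𝓝 0) := tendsto_one_div_add_atTop_nhds_zero_nat
  have hrat : ∀ᶠ n in atTop, (β n).rOut ≤ 2 * (β n).rIn := by
    refine Eventually.of_forall fun n => ?_
    change 1 / ((n : ℝ) + 1) ≤ 2 * (1 / (2 * ((n : ℝ) + 1)))
    apply le_of_eq
    field_simp
  set ρ : ℝ → ℝ := (β 0).normed volume with hρ
  have hρi : Integrable (fun t => ρ t ^ 2) volume := by
    have h1 : Continuous fun t => ρ t ^ 2 := ((β 0).continuous_normed).pow 2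
    refine h1.integrable_of_hasCompactSupport ?_
    exact ((β 0).hasCompactSupport_normed (μ := volume)).comp_left (g := fun y => y ^ 2) (by simp)
  have hsupp : ∀ m x, ∀ t, t ∉ Icc (x - 1) (x + 1) → (β m).normed volume (x - t) = 0 := by
    intro m x t ht
    by_contra h0
    have h1 : x - t ∈ Metric.ball (0 : ℝ) (β m).rOut := by
      rw [← (β m).support_normed_eq (μ := volume)]
      exact h0
    rw [Metric.mem_ball, dist_zero_right, Real.norm_eq_abs, abs_lt] at h1
    have := hout1 m
    exact ht ⟨by linarith, by linarith⟩
  have hsm : ∀ m (x : ℝ), ContDiff ℝ ∞ fun t => (β m).normed volume (x - t) := fun m x =>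
    ((β m).contDiff_normed).comp (contDiff_const.sub contDiff_id)
  have hcs : ∀ m (x : ℝ), HasCompactSupport fun t => (β m).normed volume (x - t) := fun m x =>
    HasCompactSupport.intro isCompact_Icc (hsupp m x)
  have hint : ∀ m (x : ℝ), ∫ t, (β m).normed volume (x - t) = 1 := fun m x => by
    rw [integral_sub_left_eq_self (fun t => (β m).normed volume t) volume x]
    exact (β m).integral_normed
  let δ : ℕ → ℝ → W12Graph →L[ℂ] ℂ := fun n x =>
    (innerSL ℂ (testL2 _ (hsm n x).continuous (hcs n x))).comp graphFst
  have hδ : ∀ n x u, δ n x u = ∫ t, (β n).normed volume (x - t) • graphFst u t := fun n x u =>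
    inner_testL2 _ _ _
  -- For `‖u‖ = 1`: comparing mollifiers `n` and `0` costs `4 + 2‖u'‖²`, and mollifier `0` itself
  -- contributes at most `∫ ρ² + ‖u‖²` (`L²` norms). Both squares are at most 1, whence `4 + 2 + 1`.
  set C : ℝ := 7 + ∫ t, ρ t ^ 2 with hC
  have hI0 : 0 ≤ ∫ t, ρ t ^ 2 := integral_nonneg fun t => sq_nonneg _
  have hC0 : 0 ≤ C := by linarith
  refine ⟨C, hC0, δ, fun n x => ?_, fun u => ?_⟩
  · refine ContinuousLinearMap.opNorm_le_of_unit_norm hC0 fun u hu1 => ?_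
    have hn := W12Graph_norm_sq u
    rw [hu1, ← graphFst_apply, ← graphSnd_apply] at hn
    have h1 := norm_integral_sub_le u.2 x (hsm n x) (hsm 0 x) (fun t => (β n).nonneg_normed _)
      (fun t => (β 0).nonneg_normed _) (hint n x) (hint 0 x) (hsupp n x) (hsupp 0 x)
    rw [integral_normSq] at h1
    have h2 : ‖∫ t, (β 0).normed volume (x - t) • graphFst u t‖
        ≤ (∫ t, ρ t ^ 2) + ‖graphFst u‖ ^ 2 := by
      rw [← integral_sub_left_eq_self (fun t => ρ t ^ 2) volume x, ← integral_normSq,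
        ← integral_add (hρi.comp_sub_left x) (integrable_normSq _)]
      refine norm_integral_le_of_norm_le ((hρi.comp_sub_left x).add (integrable_normSq _))
        (ae_of_all _ fun t => ?_)
      rw [norm_smul, Real.norm_eq_abs, ← sq_abs (ρ (x - t))]
      nlinarith [sq_nonneg (|ρ (x - t)| - ‖graphFst u t‖), sq_nonneg (|ρ (x - t)|),
        sq_nonneg ‖graphFst u t‖]
    rw [hδ]
    calc _ = ‖((∫ t, (β n).normed volume (x - t) • graphFst u t)
            - ∫ t, (β 0).normed volume (x - t) • graphFst u t)
            + ∫ t, (β 0).normed volume (x - t) • graphFst u t‖ := by rw [sub_add_cancel]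
      _ ≤ (4 + 2 * ‖graphSnd u‖ ^ 2) + ((∫ t, ρ t ^ 2) + ‖graphFst u‖ ^ 2) :=
          (norm_add_le _ _).trans (add_le_add h1 h2)
      _ ≤ C := by nlinarith [sq_nonneg ‖graphSnd u‖, sq_nonneg ‖graphFst u‖]
  · filter_upwards [ContDiffBump.ae_convolution_tendsto_right_of_locallyIntegrable
      (μ := (volume : Measure ℝ)) hlim hrat (locInt (graphFst u))] with x hx
    refine hx.congr fun n => ?_
    rw [hδ, convolution_eq_swap]
    simp only [ContinuousLinearMap.lsmul_apply]

/-- Bessel's inequality for the Riesz representative of `f`. -/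
lemma sum_norm_apply_sq_le {E κ : Type*} [NormedAddCommGroup E] [InnerProductSpace ℂ E]
    [CompleteSpace E] (f : E →L[ℂ] ℂ) {e : κ → E} (he : Orthonormal ℂ e) (s : Finset κ) :
    ∑ j ∈ s, ‖f (e j)‖ ^ 2 ≤ ‖f‖ ^ 2 := by
  set k := (InnerProductSpace.toDual ℂ E).symm f with hk
  have h := he.sum_inner_products_le k (s := s)
  rw [hk, LinearIsometryEquiv.norm_map] at h
  refine le_trans (le_of_eq (Finset.sum_congr rfl fun j _ => ?_)) h
  rw [← inner_conj_symm, RCLike.norm_conj, InnerProductSpace.toDual_symm_apply]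

/-- Elements of `W12` are classes of functions, so Bessel is applied to the mollified evaluations,
which are defined at every point, and then `n → ∞`. The exceptional null set may depend on the
finite set `s`, but `C` does not. -/
lemma exists_ae_bounds : ∃ C : ℝ, 0 ≤ C ∧
    (∀ u : W12Graph, ∀ᵐ x, ‖graphFst u x‖ ≤ C * ‖u‖) ∧
    ∀ {κ : Type} (e : κ → W12Graph), Orthonormal ℂ e → ∀ s : Finset κ,
      ∀ᵐ x, ∑ j ∈ s, ‖graphFst (e j) x‖ ^ 2 ≤ C ^ 2 := by
  obtain ⟨C, hC, δ, h1, h2⟩ := exists_mollified_eval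
  refine ⟨C, hC, fun u => ?_, fun {κ} e he s => ?_⟩
  · filter_upwards [h2 u] with x hx
    exact le_of_tendsto hx.norm (Eventually.of_forall fun n => (δ n x).le_of_opNorm_le (h1 n x) u)
  · have : ∀ᵐ x, ∀ j ∈ s, Tendsto (fun n => δ n x (e j)) atTop (𝓝 (graphFst (e j) x)) :=
      (ae_ball_iff s.countable_toSet).mpr fun j _ => h2 (e j)
    filter_upwards [this] with x hx
    refine le_of_tendsto (tendsto_finsetSum s fun j hj => ((hx j hj).norm.pow 2))
      (Eventually.of_forall fun n => ?_)
    exact (sum_norm_apply_sq_le (δ n x) he s).trans (by gcongr; exact h1 n x)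

/-! ### Multiplication by a square integrable function -/

lemma memLp_mul_graph {m : ℝ → ℂ} (hm : MemLp m 2 (volume : Measure ℝ)) (u : W12Graph) :
    MemLp (fun x => m x * graphFst u x) 2 (volume : Measure ℝ) := by
  obtain ⟨C, -, h, -⟩ := exists_ae_bounds
  refine MemLp.of_le_mul (c := C * ‖u‖) hm
    (hm.aestronglyMeasurable.mul (Lp.aestronglyMeasurable _)) ?_
  filter_upwards [h u] with x hx
  rw [norm_mul, mul_comm]
  exact mul_le_mul_of_nonneg_right hx (norm_nonneg _)

/-- Multiplication by the square integrable function `m`, from `W^{1,2}(ℝ)` to `L²(ℝ)`. -/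
def mulGraph (m : ℝ → ℂ) (hm : MemLp m 2 (volume : Measure ℝ)) : W12Graph →L[ℂ] L2R :=
  LinearMap.mkContinuousOfExistsBound
    { toFun := fun u => (memLp_mul_graph hm u).toLp _
      map_add' := fun u v => by
        rw [← MemLp.toLp_add]
        refine MemLp.toLp_congr _ _ ?_
        filter_upwards [Lp.coeFn_add (graphFst u) (graphFst v)] with x hx
        rw [map_add, hx, Pi.add_apply, Pi.add_apply, mul_add]
      map_smul' := fun c u => by
        rw [RingHom.id_apply, ← MemLp.toLp_const_smul]
        refine MemLp.toLp_congr _ _ ?_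
        filter_upwards [Lp.coeFn_smul c (graphFst u)] with x hx
        rw [map_smul, hx, Pi.smul_apply, Pi.smul_apply, smul_eq_mul, smul_eq_mul]
        ring }
    (by
      obtain ⟨C, hC, h, -⟩ := exists_ae_bounds
      refine ⟨C * ‖hm.toLp m‖, fun u => ?_⟩
      have : ‖(memLp_mul_graph hm u).toLp _‖ ≤ (C * ‖u‖) * ‖hm.toLp m‖ := by
        refine Lp.norm_le_mul_norm_of_ae_le_mul ?_
        filter_upwards [h u, (memLp_mul_graph hm u).coeFn_toLp, hm.coeFn_toLp] with x h1 h2 h3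
        rw [h2, h3, norm_mul, mul_comm]
        exact mul_le_mul_of_nonneg_right h1 (norm_nonneg _)
      exact this.trans (le_of_eq (by ring)))

lemma coeFn_mulGraph {m : ℝ → ℂ} (hm : MemLp m 2 (volume : Measure ℝ)) (u : W12Graph) :
    mulGraph m hm u =ᵐ[volume] fun x => m x * graphFst u x :=
  (memLp_mul_graph hm u).coeFn_toLp

/-- Multiplication by a square integrable function is Hilbert-Schmidt. -/
lemma exists_sum_norm_mulGraph_sq_le {m : ℝ → ℂ} (hm : MemLp m 2 (volume : Measure ℝ)) :
    ∃ C : ℝ, ∀ {κ : Type} (e : κ → W12Graph), Orthonormal ℂ e → ∀ s : Finset κ,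
      ∑ j ∈ s, ‖mulGraph m hm (e j)‖ ^ 2 ≤ C := by
  obtain ⟨C, -, -, h⟩ := exists_ae_bounds
  have hmi : Integrable (fun x => ‖m x‖ ^ 2) volume := hm.integrable_norm_pow (by norm_num)
  refine ⟨C ^ 2 * ∫ x, ‖m x‖ ^ 2, fun {κ} e he s => ?_⟩
  simp only [← integral_normSq]
  rw [← integral_finsetSum _ fun j _ => integrable_normSq _, ← integral_const_mul]
  refine integral_mono_ae (integrable_finsetSum _ fun j _ => integrable_normSq _)
    (hmi.const_mul _) ?_
  have h2 : ∀ᵐ x, ∀ j ∈ s, mulGraph m hm (e j) x = m x * graphFst (e j) x :=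
    (ae_ball_iff s.countable_toSet).mpr fun j _ => coeFn_mulGraph hm (e j)
  filter_upwards [h e he s, h2] with x hx hx2
  calc ∑ j ∈ s, ‖mulGraph m hm (e j) x‖ ^ 2
      = (∑ j ∈ s, ‖graphFst (e j) x‖ ^ 2) * ‖m x‖ ^ 2 := by
        rw [Finset.sum_mul]
        refine Finset.sum_congr rfl fun j hj => ?_
        rw [hx2 j hj, norm_mul]
        ring
    _ ≤ C ^ 2 * ‖m x‖ ^ 2 := mul_le_mul_of_nonneg_right hx (by positivity)

/-! ### The form of `H` and the resolvent -/

lemma inner_L2R (u v : L2R) : inner ℂ v u = ∫ x, u x * conj (v x) := by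
  rw [L2.inner_def]
  simp

lemma coeFn_sgnMul (u : L2R) :
    sgnMul u =ᵐ[volume] fun x => ((Real.sign x : ℝ) : ℂ) * u x :=
  (memLp_sign_mul u).coeFn_toLp

lemma inner_sgnMul (u v : L2R) : inner ℂ v (sgnMul u)
    = (∫ x in Ioi (0 : ℝ), u x * conj (v x)) - ∫ x in Iio (0 : ℝ), u x * conj (v x) := by
  have h := integrable_mul_conj u v
  rw [inner_L2R, ← integral_indicator measurableSet_Ioi, ← integral_indicator measurableSet_Iio,
    ← integral_sub (h.indicator measurableSet_Ioi) (h.indicator measurableSet_Iio)]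
  refine integral_congr_ae ?_
  filter_upwards [coeFn_sgnMul u] with x hx
  rw [hx]
  rcases lt_trichotomy x 0 with h0 | h0 | h0
  · simp [Real.sign_of_neg h0, h0, not_lt.mpr h0.le]
  · simp [h0]
  · simp [Real.sign_of_pos h0, h0, not_lt.mpr h0.le]

lemma formH_eq_inner (ψ φ : W12) : formH ψ φ
    = inner ℂ (weakDeriv φ) (weakDeriv ψ) + Complex.I * inner ℂ (φ : L2R) (sgnMul ψ) := by
  rw [formH, inner_sgnMul, inner_L2R]
  ring

lemma norm_sgnMul_le (u : L2R) : ‖sgnMul u‖ ≤ ‖u‖ := by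
  refine Lp.norm_le_norm_of_ae_le ?_
  filter_upwards [coeFn_sgnMul u] with x hx
  rw [hx, norm_mul, Complex.norm_real]
  refine mul_le_of_le_one_left (norm_nonneg _) ?_
  rcases Real.sign_apply_eq x with h | h | h <;> rw [h] <;> norm_num

/-- The bounded operator `i sgn(x) - c` in `L²(ℝ)`. -/
def sgnSub (c : ℂ) : L2R →L[ℂ] L2R :=
  Complex.I • sgnMul.mkContinuous 1 (fun u => by simpa using norm_sgnMul_le u)
    - c • ContinuousLinearMap.id ℂ L2R

lemma sgnSub_apply (c : ℂ) (u : L2R) : sgnSub c u = Complex.I • sgnMul u - c • u := rfl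

lemma W22_inner_weakDeriv (u : W22) (φ : W12) :
    inner ℂ (weakDeriv φ) (weakDeriv (Submodule.inclusion W22_le_W12 u))
      = -inner ℂ (φ : L2R) (weakDeriv2 u) :=
  (hasWeakDeriv_weakDeriv ⟨_, weakDeriv_mem_of_W22 u⟩).inner_graphSnd (graphEquiv φ)

lemma formH_eq_inner_opH (ψ : W12) (h : (ψ : L2R) ∈ opH.domain) (φ : W12) :
    formH ψ φ = inner ℂ (φ : L2R) (opH ⟨ψ, h⟩) := by
  have h1 : opH ⟨ψ, h⟩ = -weakDeriv2 ⟨ψ, h⟩ + Complex.I • sgnMul (ψ : L2R) := rfl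
  have h2 : inner ℂ (weakDeriv φ) (weakDeriv ψ) = -inner ℂ (φ : L2R) (weakDeriv2 ⟨ψ, h⟩) :=
    W22_inner_weakDeriv ⟨ψ, h⟩ φ
  rw [formH_eq_inner, h2, h1, inner_add_right, inner_neg_right, inner_smul_right]

/-- A weak solution of `H ψ = z ψ` is an eigenfunction of `H`. -/
lemma exists_opH_eq_of_formH {z : ℂ} {ψ : W12}
    (h : ∀ φ : W12, formH ψ φ = z * inner ℂ (φ : L2R) (ψ : L2R)) :
    ∃ u : opH.domain, (u : L2R) = ψ ∧ opH u = z • (u : L2R) := by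
  -- Regularity: tested against smooth functions, the equation reads `ψ'' = (i sgn - z) ψ`, with
  -- right side in `L²`.
  have hd : HasWeakDeriv (weakDeriv ψ) (sgnSub z ψ) := by
    rw [hasWeakDeriv_iff_inner]
    intro φ h1 h2
    have h3 := h (graphEquiv.symm (testGraph φ h1 h2))
    rw [formH_eq_inner, ← graphEquiv_snd (graphEquiv.symm _), LinearEquiv.apply_symm_apply,
      coe_graphEquiv_symm] at h3
    rw [sgnSub_apply, inner_sub_right, inner_smul_right, inner_smul_right]
    change inner ℂ (testGraph φ h1 h2).1.snd _ = -(_ * inner ℂ (testGraph φ h1 h2).1.fst _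
      - _ * inner ℂ (testGraph φ h1 h2).1.fst _)
    linear_combination h3
  have hm : (ψ : L2R) ∈ W22 := ⟨ψ, ⟨_, hd⟩, rfl⟩
  refine ⟨⟨ψ, hm⟩, rfl, ?_⟩
  have h2 : weakDeriv2 ⟨ψ, hm⟩ = sgnSub z ψ :=
    (hasWeakDeriv_weakDeriv ⟨_, weakDeriv_mem_of_W22 ⟨ψ, hm⟩⟩).unique hd
  change -weakDeriv2 ⟨ψ, hm⟩ + Complex.I • sgnMul (ψ : L2R) = z • (ψ : L2R)
  rw [h2, sgnSub_apply]
  abel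

/-- Regularity turns `ψ` into a vector of the domain of `H` annihilated by `H - z`, and the
resolvent is a left inverse. -/
lemma eq_zero_of_formH {z : ℂ} (hz : z ∈ resolventSet opH) {ψ : W12}
    (h : ∀ φ : W12, formH ψ φ = z * inner ℂ (φ : L2R) (ψ : L2R)) : ψ = 0 := by
  obtain ⟨R, -, h2⟩ := hz
  obtain ⟨u, hu, hu2⟩ := exists_opH_eq_of_formH h
  have := h2 u
  rw [hu2, sub_self, map_zero] at this
  exact Subtype.ext (hu.symm.trans this.symm)

/-- The resolvent of `H` is bounded from `L²(ℝ)` to `W^{1,2}(ℝ)`. -/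
lemma exists_resolvent {z : ℂ} (hz : z ∈ resolventSet opH) : ∃ R : L2R →L[ℂ] W12Graph,
    ∀ (f : L2R) (φ : W12), formH (graphEquiv.symm (R f)) φ
      - z * inner ℂ (φ : L2R) (graphEquiv.symm (R f) : L2R) = inner ℂ (φ : L2R) f := by
  obtain ⟨R, h1, -⟩ := hz
  have hmem : ∀ f, R f ∈ W12 := fun f => W22_le_W12 (h1 f).1
  let g : L2R →ₗ[ℂ] W12Graph :=
    graphEquiv.toLinearMap ∘ₗ (R : L2R →ₗ[ℂ] L2R).codRestrict W12 hmem
  have hg : ∀ f, graphFst (g f) = R f := fun f => rfl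
  -- Closed graph theorem: a limit in `W^{1,2}` is also the limit in `L²`, where `R` is already
  -- continuous.
  refine ⟨ContinuousLinearMap.ofSeqClosedGraph (g := g) fun u x y hu hy => ?_, fun f φ => ?_⟩
  · refine graphFst_injective (tendsto_nhds_unique
      ((graphFst.continuous.tendsto y).comp hy) ?_)
    exact (R.continuous.tendsto x).comp hu
  · obtain ⟨hf, h2⟩ := h1 f
    rw [ContinuousLinearMap.coeFn_ofSeqClosedGraph, formH_eq_inner_opH _ hf,
      ← inner_smul_right, ← inner_sub_right]
    exact congrArg _ h2

/-- The bounded operator `(H - z)⁻¹ (1 - d²/dx²)` in `W^{1,2}(ℝ)`. -/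
lemma exists_solution_operator {z : ℂ} (hz : z ∈ resolventSet opH) :
    ∃ T : W12Graph →L[ℂ] W12Graph, ∀ (k : W12Graph) (φ : W12),
      formH (graphEquiv.symm (T k)) φ - z * inner ℂ (φ : L2R) (graphEquiv.symm (T k) : L2R)
        = inner ℂ (graphEquiv φ) k := by
  obtain ⟨R, hR⟩ := exists_resolvent hz
  -- Formally `(H - z) k = (1 - d²/dx²) k + (i sgn - 1 - z) k`. The last term lies in `L²`, so the
  -- resolvent removes it.
  refine ⟨ContinuousLinearMap.id ℂ _ - R.comp ((sgnSub (1 + z)).comp graphFst), fun k φ => ?_⟩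
  obtain ⟨f, hf⟩ : ∃ f, f = sgnSub (1 + z) (graphFst k) := ⟨_, rfl⟩
  have h1 := hR f φ
  have h2 : graphEquiv.symm ((ContinuousLinearMap.id ℂ W12Graph
      - R.comp ((sgnSub (1 + z)).comp graphFst)) k)
      = graphEquiv.symm k + (-1 : ℂ) • graphEquiv.symm (R f) := by
    rw [neg_one_smul, ← sub_eq_add_neg, ← map_sub]
    rw [hf]
    rfl
  have h3 := congrArg (inner ℂ (φ : L2R)) hf
  rw [h2, formH_add, formH_smul, Submodule.coe_add, Submodule.coe_smul, inner_add_right,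
    inner_smul_right, W12Graph_inner, formH_eq_inner (graphEquiv.symm k),
    ← graphEquiv_snd (graphEquiv.symm k), LinearEquiv.apply_symm_apply]
  rw [sgnSub_apply, inner_sub_right, inner_smul_right, inner_smul_right] at h3
  simp only [graphFst_apply, graphEquiv_fst, graphEquiv_snd, coe_graphEquiv_symm] at h1 h3 ⊢
  linear_combination -h1 - h3

/-! ### The factors of the potential -/

section Potential

variable {V : ℝ → ℂ}

lemma norm_absSqrt_sq (V : ℝ → ℂ) (x : ℝ) : ‖absSqrt V x‖ ^ 2 = ‖V x‖ := by
  rw [absSqrt, Complex.norm_real, Real.norm_eq_abs, sq_abs, Real.sq_sqrt (norm_nonneg _)]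

lemma norm_sgnSqrt (V : ℝ → ℂ) (x : ℝ) : ‖sgnSqrt V x‖ = ‖absSqrt V x‖ := by
  rw [sgnSqrt, norm_mul, mul_comm Complex.I, Complex.norm_exp_ofReal_mul_I, mul_one]

lemma sgnSqrt_mul_absSqrt (V : ℝ → ℂ) (x : ℝ) : sgnSqrt V x * absSqrt V x = V x := by
  have h : absSqrt V x * absSqrt V x = (‖V x‖ : ℂ) := by
    rw [absSqrt, ← Complex.ofReal_mul, Real.mul_self_sqrt (norm_nonneg _)]
  rw [sgnSqrt, mul_right_comm, h, mul_comm Complex.I, Complex.norm_mul_exp_arg_mul_I]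

lemma memLp_absSqrt (hV : Integrable V) : MemLp (absSqrt V) 2 volume := by
  have hm : AEStronglyMeasurable (absSqrt V) volume :=
    (Complex.continuous_ofReal.comp
      (Real.continuous_sqrt.comp continuous_norm)).comp_aestronglyMeasurable
      hV.aestronglyMeasurable
  rw [memLp_two_iff_integrable_sq_norm hm]
  simpa only [norm_absSqrt_sq] using hV.norm

lemma memLp_conj_sgnSqrt (hV : Integrable V) :
    MemLp (fun x => conj (sgnSqrt V x)) 2 volume := by
  refine (memLp_absSqrt hV).of_le ?_ (ae_of_all _ fun x => ?_)
  · refine Complex.continuous_conj.comp_aestronglyMeasurable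
      ((memLp_absSqrt hV).aestronglyMeasurable.mul ?_)
    have : Measurable fun w : ℂ => Complex.exp (Complex.I * (Complex.arg w : ℂ)) :=
      Complex.measurable_exp.comp
        (measurable_const.mul (Complex.measurable_ofReal.comp Complex.measurable_arg))
    exact (this.comp_aemeasurable hV.aemeasurable).aestronglyMeasurable
  · rw [RCLike.norm_conj, norm_sgnSqrt]

/-- This is the Riesz representation of the functional `V_{1/2} g`, and the source of the factor
`B*` in `K`. -/
lemma integral_sgnSqrt_mul (hV : Integrable V) (g : L2R) (φ : W12) :
    ∫ x, sgnSqrt V x * g x * conj ((φ : L2R) x)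
      = inner ℂ (graphEquiv φ)
          ((mulGraph (fun x => conj (sgnSqrt V x)) (memLp_conj_sgnSqrt hV)).adjoint g) := by
  rw [ContinuousLinearMap.adjoint_inner_right, inner_L2R]
  refine integral_congr_ae ?_
  filter_upwards [coeFn_mulGraph (memLp_conj_sgnSqrt hV) (graphEquiv φ)] with x hx
  rw [hx, map_mul, Complex.conj_conj, graphFst_apply, graphEquiv_fst]
  ring

/-- The factorisation `V = V_{1/2} |V|^{1/2}` turns the source term of the weak equation into the
perturbation form. -/
lemma integral_sgnSqrt_eq_formV {c : ℂ} {g : L2R} {ψ : W12}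
    (h : g =ᵐ[volume] fun x => c * (absSqrt V x * (ψ : L2R) x)) (φ : W12) :
    ∫ x, sgnSqrt V x * g x * conj ((φ : L2R) x) = c * formV V ψ φ := by
  rw [formV, ← integral_const_mul]
  refine integral_congr_ae ?_
  filter_upwards [h] with x hx
  rw [hx, ← sgnSqrt_mul_absSqrt V x]
  ring

/-! ### Unique solvability and the operator `K` -/

lemma IsWeakSol.unique {z : ℂ} (hz : z ∈ resolventSet opH) {g : L2R} {ψ ψ' : W12}
    (h : IsWeakSol V z g ψ) (h' : IsWeakSol V z g ψ') : ψ = ψ' := by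
  have : ψ + (-1 : ℂ) • ψ' = 0 := by
    refine eq_zero_of_formH hz fun φ => ?_
    rw [formH_add, formH_smul, Submodule.coe_add, Submodule.coe_smul, inner_add_right,
      inner_smul_right]
    linear_combination (h' φ) - (h φ)
  rwa [neg_one_smul, ← sub_eq_add_neg, sub_eq_zero] at this

/-- The Birman-Schwinger operator exists and is Hilbert-Schmidt. -/
lemma exists_isBirmanSchwinger (hV : Integrable V) {z : ℂ} (hz : z ∈ resolventSet opH) :
    ∃ K : L2R →L[ℂ] L2R, IsBirmanSchwinger V z K ∧ IsHilbertSchmidt K := by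
  obtain ⟨T, hT⟩ := exists_solution_operator hz
  set A := mulGraph (absSqrt V) (memLp_absSqrt hV) with hA
  set B := mulGraph (fun x => conj (sgnSqrt V x)) (memLp_conj_sgnSqrt hV) with hB
  have hsol : ∀ g, IsWeakSol V z g (graphEquiv.symm (T (B.adjoint g))) := fun g φ => by
    rw [hT, integral_sgnSqrt_mul hV]
  refine ⟨(A.comp T).comp B.adjoint, fun g => ⟨⟨_, hsol g, fun ψ hψ => hψ.unique hz (hsol g)⟩,
    fun ψ hψ => ?_⟩, fun ι b => ?_⟩
  · rw [hψ.unique hz (hsol g)]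
    exact coeFn_mulGraph (memLp_absSqrt hV) _
  · obtain ⟨C, hC⟩ := exists_sum_norm_mulGraph_sq_le (memLp_conj_sgnSqrt hV)
    obtain ⟨w, e, -⟩ := exists_hilbertBasis ℂ W12Graph
    -- The Hilbert–Schmidt bound holds for `B` on `W^{1,2}`; it passes to `B*` and survives
    -- composition with the bounded `A T`.
    have hs : Summable fun i => ‖B.adjoint (b i)‖ ^ 2 :=
      summable_of_sum_le (fun _ => by positivity) fun s =>
        sum_norm_adjoint_sq_le B e (fun t => hC e e.orthonormal t) b.orthonormal s
    refine (hs.mul_left (‖A.comp T‖ ^ 2)).of_nonneg_of_le (fun _ => by positivity) fun i => ?_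
    rw [← mul_pow]
    exact pow_le_pow_left₀ (norm_nonneg _) ((A.comp T).le_opNorm _) 2

lemma IsBirmanSchwinger.unique {z : ℂ} {K K' : L2R →L[ℂ] L2R} (h : IsBirmanSchwinger V z K)
    (h' : IsBirmanSchwinger V z K') : K = K' := by
  ext1 g
  obtain ⟨ψ, hψ, -⟩ := (h g).1
  exact Lp.ext (((h g).2 ψ hψ).trans ((h' g).2 ψ hψ).symm)

/-! ### Correspondence of eigenvectors -/

lemma mem_pointSpectrum_opPert (hV : Integrable V) (ε : ℝ) (z : ℂ) :
    z ∈ pointSpectrum (opPert V hV ε) ↔ ∃ ψ : W12, ψ ≠ 0 ∧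
      ∀ φ : W12, formPert V ε ψ φ = z * inner ℂ (φ : L2R) (ψ : L2R) := by
  constructor
  · rintro ⟨u, hu0, hu⟩
    have h := (opPert V hV ε).mem_graph u
    rw [opPert_graph, hu] at h
    obtain ⟨ψ, h1, h2⟩ := h
    have h1' : (ψ : L2R) = u := h1
    refine ⟨ψ, fun h0 => hu0 ?_, fun φ => ?_⟩
    · rw [← h1', h0, Submodule.coe_zero]
    · rw [h2, inner_smul_right, h1']
  · rintro ⟨ψ, h0, h⟩
    have hm : ((ψ : L2R), z • (ψ : L2R)) ∈ (opPert V hV ε).graph := by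
      rw [opPert_graph]
      exact ⟨ψ, rfl, fun φ => by rw [h, inner_smul_right]⟩
    rw [LinearPMap.mem_graph_iff] at hm
    obtain ⟨u, hu1, hu2⟩ := hm
    have hu1' : (u : L2R) = ψ := hu1
    refine ⟨u, fun h' => h0 (Subtype.ext (hu1'.symm.trans h')), ?_⟩
    rw [hu1']
    exact hu2

/-- The Birman-Schwinger principle, for eigenvectors. -/
lemma mem_pointSpectrum_iff_exists (hV : Integrable V) {z : ℂ} (hz : z ∈ resolventSet opH)
    {K : L2R →L[ℂ] L2R} (hK : IsBirmanSchwinger V z K) (ε : ℝ) :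
    z ∈ pointSpectrum (opPert V hV ε) ↔ ∃ g : L2R, g ≠ 0 ∧ (ε : ℂ) • K g = -g := by
  rw [mem_pointSpectrum_opPert]
  constructor
  · rintro ⟨ψ, h0, h⟩
    set g : L2R := mulGraph (absSqrt V) (memLp_absSqrt hV) (graphEquiv ψ) with hg
    have hgae : g =ᵐ[volume] fun x => absSqrt V x * (ψ : L2R) x := coeFn_mulGraph _ _
    have hgε : (-(ε : ℂ)) • g =ᵐ[volume] fun x => -(ε : ℂ) * (absSqrt V x * (ψ : L2R) x) := by
      filter_upwards [hgae, Lp.coeFn_smul (-(ε : ℂ)) g] with x h1 h2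
      rw [h2, Pi.smul_apply, h1, smul_eq_mul]
    -- Moving `ε v` to the other side makes `-ε g` the source; keeping `ε` as a factor avoids a
    -- separate case `ε = 0`.
    have hsol : IsWeakSol V z ((-(ε : ℂ)) • g) ψ := fun φ => by
      rw [integral_sgnSqrt_eq_formV hgε, ← h, formPert]
      ring
    have hKg : K ((-(ε : ℂ)) • g) = g := Lp.ext (((hK _).2 ψ hsol).trans hgae.symm)
    refine ⟨g, fun hg0 => h0 ?_, ?_⟩
    -- If `|V|^{1/2} ψ = 0`, the source vanishes and `ψ` solves the homogeneous equation, impossible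
    -- for `ψ ≠ 0` off `σ(H)`.
    · refine eq_zero_of_formH hz fun φ => ?_
      have h1 := hsol φ
      have h2 : g =ᵐ[volume] fun x => 0 * (absSqrt V x * (ψ : L2R) x) := by
        rw [hg0]
        filter_upwards [Lp.coeFn_zero ℂ 2 (volume : Measure ℝ)] with x hx
        rw [hx, zero_mul, Pi.zero_apply]
      rw [hg0, smul_zero, ← hg0, integral_sgnSqrt_eq_formV h2, zero_mul] at h1
      exact (sub_eq_zero.mp h1.symm)
    · rw [map_smul, neg_smul] at hKg
      rw [← neg_eq_iff_eq_neg]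
      exact hKg
  · rintro ⟨g, h0, hg⟩
    obtain ⟨ψ, hψ, -⟩ := (hK g).1
    -- Conversely `g = -ε K g = -ε |V|^{1/2} ψ`, so the source of `ψ` becomes `-ε V ψ`, and `ψ = 0`
    -- would force `g = 0`.
    have hgae : g =ᵐ[volume] fun x => -(ε : ℂ) * (absSqrt V x * (ψ : L2R) x) := by
      have h1 : g = (-(ε : ℂ)) • K g := by rw [neg_smul, hg, neg_neg]
      filter_upwards [(hK g).2 ψ hψ, Lp.coeFn_smul (-(ε : ℂ)) (K g)] with x h2 h3
      rw [h1, h3, Pi.smul_apply, h2, smul_eq_mul]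
    refine ⟨ψ, fun hψ0 => h0 ?_, fun φ => ?_⟩
    · refine Lp.ext ?_
      filter_upwards [hgae, Lp.coeFn_zero ℂ 2 (volume : Measure ℝ)] with x hx hx0
      rw [hx, hx0, hψ0, Submodule.coe_zero, hx0]
      simp
    · have h1 := hψ φ
      rw [integral_sgnSqrt_eq_formV hgae] at h1
      rw [formPert]
      linear_combination -h1

end Potential

/-- Fredholm alternative: nonzero spectral points of a compact operator are eigenvalues. -/
lemma neg_one_mem_spectrum_iff {K : L2R →L[ℂ] L2R} (hK : IsCompactOperator K) :
    (-1 : ℂ) ∈ spectrum ℂ K ↔ ∃ g : L2R, g ≠ 0 ∧ K g = -g := by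
  rw [← hK.hasEigenvalue_iff_mem_spectrum (by norm_num)]
  constructor
  · intro h
    obtain ⟨g, hg⟩ := h.exists_hasEigenvector
    exact ⟨g, hg.2, by simpa using hg.apply_eq_smul⟩
  · rintro ⟨g, h0, hg⟩
    refine Module.End.hasEigenvalue_of_hasEigenvector (x := g)
      ⟨Module.End.mem_eigenspace_iff.mpr ?_, h0⟩
    simpa using hg

end BirmanSchwinger

end

theorem theorem5 (V : ℝ → ℂ) (hV : MeasureTheory.Integrable V) (z : ℂ)
    (hz : z ∉ BirmanSchwinger.spec BirmanSchwinger.opH) :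
    (∃! K : BirmanSchwinger.L2R →L[ℂ] BirmanSchwinger.L2R,
      BirmanSchwinger.IsBirmanSchwinger V z K) ∧
    ∀ K : BirmanSchwinger.L2R →L[ℂ] BirmanSchwinger.L2R,
      BirmanSchwinger.IsBirmanSchwinger V z K →
        BirmanSchwinger.IsHilbertSchmidt K ∧
        ∀ ε : ℝ, z ∈ BirmanSchwinger.pointSpectrum (BirmanSchwinger.opPert V hV ε) ↔
          (-1 : ℂ) ∈ spectrum ℂ ((ε : ℂ) • K) := by
  have hz' : z ∈ BirmanSchwinger.resolventSet BirmanSchwinger.opH := not_not.mp hz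
  obtain ⟨K₀, h1, h2⟩ := BirmanSchwinger.exists_isBirmanSchwinger hV hz'
  refine ⟨⟨K₀, h1, fun K hK => hK.unique h1⟩, fun K hK => ?_⟩
  have hHS : BirmanSchwinger.IsHilbertSchmidt K := hK.unique h1 ▸ h2
  refine ⟨hHS, fun ε => ?_⟩
  rw [BirmanSchwinger.mem_pointSpectrum_iff_exists hV hz' hK,
    BirmanSchwinger.neg_one_mem_spectrum_iff (hHS.isCompactOperator.smul (ε : ℂ))]
  rfl
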